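/- **Conventions.** Let $D\ge 3$ be an integer and let $q\in\mathbb C^*$ be not a root of unity. For an element $x$ of a commutative ring containing $q$ put $(x;q)_n=\prod_{l=0}^{n-1}(1-xq^l)$ and $(x_1,\dots,x_r;q)_n=\prod_j (x_j;q)_n$. For scalars $a,b,c,d$ define in $\mathbb C[y,y^{-1}]$ $$p_n[y;a,b,c,d\mid q]=\sum_{j=0}^n\frac{(q^{-n},abcdq^{n-1},ay,ay^{-1};q)_j}{(ab,ac,ad,q;q)_j}q^j,\qquad P_n[y;a,b,c,d\mid q]=\frac{(ab,ac,ad;q)_n}{a^n(abcdq^{n-1};q)_n}\,p_n[y;a,b,c,d\mid q],$$ $$Q_n[y;a,b,c,d\mid q]=a^{-1}b^{-1}y^{-1}(1-ay)(1-by)P_{n-1}[y;aq,bq,c,d\mid q]\quad(n\ge1).$$ **The scalars $k_i$.** Let $\mathsf d\ge1$, let $\theta_0,\dots,\theta_{\mathsf d}$ be distinct, let $\theta^*_0,\dots,\theta^*_{\mathsf d}$ be distinct, and let $\varphi_1,\dots,\varphi_{\mathsf d}$ be nonzero; assume they belong to the parameter array of a Leonard system. Let $A$ be the lower bidiagonal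 matrix with diagonal $(\theta_i)$ and subdiagonal entries $1$, let $A^*$ be the upper bidiagonal matrix with diagonal $(\theta^*_i)$ and superdiagonal $(\varphi_1,\dots,\varphi_{\mathsf d})$, and let $E_i$, $E_i^*$ be their primitive idempotents for $\theta_i$, $\theta_i^*$. Choose $0\ne u\in E_0\mathbb C^{\mathsf d+1}$ and put $v_i=E_i^*u$ (a basis). The intersection numbers are given by $Av_i=b_{i-1}v_{i-1}+a_iv_i+c_{i+1}v_{i+1}$, and $k_i=b_0b_1\cdots b_{i-1}/(c_1c_2\cdots c_i)$ for $0\le i\le\mathsf d$. **The $q$-Racah family.** Let $\theta_0,\theta_0^*\in\mathbb C$, let $h,h^*,s,s^*,r_1,r_2$ be nonzero complex numbers, and fix square roots of $q,s,s^*,r_1,r_2$ with $r_1^{1/2}r_2^{1/2}=s^{1/2}s^{*1/2}q^{(D+1)/2}$; all square roots below are formed from these. Assume that none of $r_1q^i,r_2q^i,s^*q^i/r_1,s^*q^i/r_2$ equals $1$ for $1\le i\le D$, and that neither $sq^i$ nor $s^*q^i$ equals $1$ for $2\le i\le 2D$. Put $\theta_i=\theta_0+h(1-q^i)(1-sq^{i+1})q^{-i}$,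 $\theta^*_i=\theta^*_0+h^*(1-q^i)(1-s^*q^{i+1})q^{-i}$ for $0\le i\le D$ and $\varphi_i=hh^*q^{1-2i}(1-q^i)(1-q^{i-D-1})(1-r_1q^i)(1-r_2q^i)$ for $1\le i\le D$, and let $k_i$ $(0\le i\le D)$ be the associated scalars, with $\mathsf d=D$. Let $k^\perp_i$ $(0\le i\le D-2)$ be the scalars associated in the same way with $\mathsf d=D-2$ and with $\theta_0,\theta_0^*,h,h^*,s,s^*,r_1,r_2$ replaced by $\theta_1,\theta_1^*,hq^{-1},h^*q^{-1},sq^2,s^*q^2,r_1q,r_2q$. Put $$a=\Bigl(\tfrac{r_1r_2}{s^*q^D}\Bigr)^{1/2},\quad b=\Bigl(\tfrac{s^*}{r_1r_2q^D}\Bigr)^{1/2},\quad c=\Bigl(\tfrac{r_2s^*q^{D+2}}{r_1}\Bigr)^{1/2},\quad d=\Bigl(\tfrac{r_1s^*q^{D+2}}{r_2}\Bigr)^{1/2},$$ $$\xi_i=q^{1-i}(1-q^{i-D})(1-s^*q^{i+1}),\qquad \epsilon_i=\frac{(1-q^i)(1-s^*q^{D+i+1})}{q^D(1-q^{i-D})(1-s^*q^{i+1})}\qquad(1\le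 i\le D-1),$$ $$g[y]=b\,\frac{(1-s^*q^2)(1-s^*q^3)}{(1-s^*q/r_1)(1-s^*q/r_2)}\bigl(y-a-b+q^{-D}y^{-1}\bigr).$$ With $p_i=p_i[y;a,b,c,d\mid q]$ and $p_i^\perp=p_i[y;aq,bq,c,d\mid q]$, define Laurent polynomials $\varepsilon^{\pm}_i$ $(0\le i\le D-1)$ by $\varepsilon^-_0=1$, $\varepsilon^+_{D-1}=k_Dp_D$ and, for $1\le i\le D-1$, $$\varepsilon^+_{i-1}=\frac{\epsilon_i}{\epsilon_i-1}k_ip_i+\frac{1}{\xi_i(1-\epsilon_i)}k^\perp_{i-1}p^\perp_{i-1}g,\qquad \varepsilon^-_{i}=\frac{1}{1-\epsilon_i}k_ip_i+\frac{1}{\xi_i(\epsilon_i-1)}k^\perp_{i-1}p^\perp_{i-1}g.$$ **The $q^{-1}$-version.** Let $\varepsilon^\pm_i[y;q^{-1}]$ denote the Laurent polynomials $\varepsilon^\pm_i$ formed with $q,s,s^*,r_1,r_2$ and their square roots replaced by their inverses, $h$ by $hsq$, $h^*$ by $h^*s^*q$, and with $\theta_0,\theta_0^*,D$ unchanged; under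 this replacement $a,b,c,d$ become $a^{-1},b^{-1},c^{-1},d^{-1}$. **Proposition.** Write $P_i=P_i[y;a,b,c,d\mid q]$ and $Q_i=Q_i[y;a,b,c,d\mid q]$ for the original $a,b,c,d,q$. Then for $1\le i\le D-1$ $$\varepsilon^+_{i-1}[y;q^{-1}]=\frac{ab(1-q^i)(1-cdq^{i-1})}{ab-1}\,\frac{(abcd;q)_{2i-1}}{a^i(q,bc,bd,cd;q)_i}\,(P_i-Q_i),$$ $$\varepsilon^-_{i}[y;q^{-1}]=\frac{(1-abq^i)(1-abcdq^{i-1})}{1-ab}\,\frac{(abcd;q)_{2i-1}}{a^i(q,bc,bd,cd;q)_i}\left(P_i-\frac{ab(1-q^i)(1-cdq^{i-1})}{(1-abq^i)(1-abcdq^{i-1})}Q_i\right).$$ Moreover $$\varepsilon^-_0[y;q^{-1}]=1,\qquad \varepsilon^+_{D-1}[y;q^{-1}]=\frac{(abcd;q)_{2D-1}}{a^D(q,bc,bd;q)_D\,(cd;q)_{D-1}}\,P_D.$$ -/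

import Mathlib

noncomputable section

/-- The `q`-shifted factorial `(x;q)_n = (1-x)(1-xq)⋯(1-xq^{n-1})` in a commutative ring. -/
def qPoch {R : Type*} [CommRing R] (x q : R) (n : ℕ) : R :=
  ∏ l ∈ Finset.range n, (1 - x * q ^ l)

/-! ### Askey-Wilson polynomials, as Laurent polynomials in `y = T 1` -/

/-- `p_n(y+y⁻¹; a,b,c,d | q) = ₄φ₃(q^{-n}, abcd q^{n-1}, ay, ay⁻¹; ab, ac, ad | q, q)`,
the terminating series written as a sum over `0 ≤ j ≤ n`. -/
def awPoly (a b c d q : ℂ) (n : ℕ) : LaurentPolynomial ℂ :=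
  ∑ j ∈ Finset.range (n + 1),
    (qPoch ((q ^ n)⁻¹) q j * qPoch (a * b * c * d * q ^ ((n : ℤ) - 1)) q j /
        (qPoch (a * b) q j * qPoch (a * c) q j * qPoch (a * d) q j * qPoch q q j) * q ^ j) •
      (qPoch (LaurentPolynomial.C a * LaurentPolynomial.T 1) (LaurentPolynomial.C q) j *
        qPoch (LaurentPolynomial.C a * LaurentPolynomial.T (-1)) (LaurentPolynomial.C q) j)

/-- The monic polynomial
`P_n[y; a,b,c,d | q] = (ab,ac,ad;q)_n / (a^n (abcd q^{n-1};q)_n) · p_n`. -/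
def awMonic (a b c d q : ℂ) (n : ℕ) : LaurentPolynomial ℂ :=
  (qPoch (a * b) q n * qPoch (a * c) q n * qPoch (a * d) q n /
      (a ^ n * qPoch (a * b * c * d * q ^ ((n : ℤ) - 1)) q n)) • awPoly a b c d q n

/-- `Q_n[y; a,b,c,d | q] = a⁻¹b⁻¹y⁻¹(1-ay)(1-by) P_{n-1}[y; aq,bq,c,d | q]`, for `n ≥ 1`. -/
def awQ (a b c d q : ℂ) (n : ℕ) : LaurentPolynomial ℂ :=
  (a⁻¹ * b⁻¹) •
    (LaurentPolynomial.T (-1) * (1 - LaurentPolynomial.C a * LaurentPolynomial.T 1) *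
      (1 - LaurentPolynomial.C b * LaurentPolynomial.T 1) *
      awMonic (a * q) (b * q) c d q (n - 1))

/-! ### Parameter arrays of Leonard systems and the scalars `k_i` -/

/-- The split form of a Leonard system of diameter `d` with eigenvalues `θ`: the lower
bidiagonal matrix with diagonal `θ_0, …, θ_d` and all subdiagonal entries equal to `1`. -/
def splitA (d : ℕ) (θ : ℕ → ℂ) : Matrix (Fin (d + 1)) (Fin (d + 1)) ℂ :=
  Matrix.of fun i j =>
    if i = j then θ i else if (i : ℕ) = (j : ℕ) + 1 then 1 else 0

/-- The companion upper bidiagonal matrix with diagonal `θ*_0, …, θ*_d` and superdiagonal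
`φ_1, …, φ_d`, where `φ` is the first split sequence. -/
def splitAstar (d : ℕ) (θs φ : ℕ → ℂ) : Matrix (Fin (d + 1)) (Fin (d + 1)) ℂ :=
  Matrix.of fun i j =>
    if i = j then θs i else if (j : ℕ) = (i : ℕ) + 1 then φ j else 0

/-- The primitive idempotent of a matrix `B` with pairwise distinct eigenvalues
`t_0, …, t_d` that belongs to `t_i`. -/
def primIdem (d : ℕ) (B : Matrix (Fin (d + 1)) (Fin (d + 1)) ℂ) (t : ℕ → ℂ)
    (i : Fin (d + 1)) : Matrix (Fin (d + 1)) (Fin (d + 1)) ℂ :=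
  Polynomial.aeval B
    (∏ j ∈ Finset.univ.erase i,
      Polynomial.C ((t i - t j)⁻¹) * (Polynomial.X - Polynomial.C (t j)))

/-- The matrix whose `j`-th column is the `j`-th vector `E*_j u` of a standard basis, where
`u = E_0 e_0` is a nonzero vector in the eigenspace of `A` for `θ_0`. (The zeroth coordinate
of `E_0 e_0` is `1`, since `A` is lower triangular.) -/
def stdBasisMatrix (d : ℕ) (θ θs φ : ℕ → ℂ) : Matrix (Fin (d + 1)) (Fin (d + 1)) ℂ :=
  Matrix.of fun i j =>
    (primIdem d (splitAstar d θs φ) θs j).mulVec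
      ((primIdem d (splitA d θ) θ 0).mulVec (Pi.single 0 1)) i

/-- The matrix that represents `A` relative to a standard basis. It is tridiagonal; its
`(i, i+1)`, `(i, i)` and `(i, i-1)` entries are the intersection numbers `b_i`, `a_i`, `c_i`. -/
def intersectionMatrix (d : ℕ) (θ θs φ : ℕ → ℂ) : Matrix (Fin (d + 1)) (Fin (d + 1)) ℂ :=
  (stdBasisMatrix d θ θs φ)⁻¹ * splitA d θ * stdBasisMatrix d θ θs φ

/-- The intersection number `b_i` (`0 ≤ i ≤ d - 1`). -/
def bNum (d : ℕ) (θ θs φ : ℕ → ℂ) (i : ℕ) : ℂ :=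
  intersectionMatrix d θ θs φ (Fin.ofNat (d + 1) i) (Fin.ofNat (d + 1) (i + 1))

/-- The intersection number `c_i` (`1 ≤ i ≤ d`). -/
def cNum (d : ℕ) (θ θs φ : ℕ → ℂ) (i : ℕ) : ℂ :=
  intersectionMatrix d θ θs φ (Fin.ofNat (d + 1) i) (Fin.ofNat (d + 1) (i - 1))

/-- `k_i = b_0 b_1 ⋯ b_{i-1} / (c_1 c_2 ⋯ c_i)` (`0 ≤ i ≤ d`). -/
def kNum (d : ℕ) (θ θs φ : ℕ → ℂ) (i : ℕ) : ℂ :=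
  (∏ j ∈ Finset.range i, bNum d θ θs φ j) / ∏ j ∈ Finset.range i, cNum d θ θs φ (j + 1)

/-! ### The `q`-Racah family -/

/-- The scalars of a `q`-Racah parameter array, with fixed square roots of
`q, s, s*, r_1, r_2` (the fields whose names end in `h`). -/
structure QRacahParams where
  /-- `q^{1/2}` -/
  qh : ℂ
  /-- `s^{1/2}` -/
  sh : ℂ
  /-- `s*^{1/2}` -/
  ssh : ℂ
  /-- `r_1^{1/2}` -/
  r1h : ℂ
  /-- `r_2^{1/2}` -/
  r2h : ℂ
  /-- `h` -/
  h : ℂ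
  /-- `h*` -/
  hs : ℂ
  /-- `θ_0` -/
  θ0 : ℂ
  /-- `θ*_0` -/
  θs0 : ℂ

namespace QRacahParams

def q (p : QRacahParams) : ℂ := p.qh ^ 2

def s (p : QRacahParams) : ℂ := p.sh ^ 2

/-- `s*` -/
def ss (p : QRacahParams) : ℂ := p.ssh ^ 2

def r1 (p : QRacahParams) : ℂ := p.r1h ^ 2

def r2 (p : QRacahParams) : ℂ := p.r2h ^ 2

/-- The standing assumptions on a `q`-Racah parameter array of diameter `d`. -/
structure IsQRacah (p : QRacahParams) (d : ℕ) : Prop where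
  qh_ne : p.qh ≠ 0
  q_not_root : ∀ n : ℕ, 1 ≤ n → p.q ^ n ≠ 1
  sh_ne : p.sh ≠ 0
  ssh_ne : p.ssh ≠ 0
  r1h_ne : p.r1h ≠ 0
  r2h_ne : p.r2h ≠ 0
  h_ne : p.h ≠ 0
  hs_ne : p.hs ≠ 0
  /-- `r_1^{1/2} r_2^{1/2} = s^{1/2} s*^{1/2} q^{(d+1)/2}`, whence `r_1 r_2 = s s* q^{d+1}` -/
  r_mul : p.r1h * p.r2h = p.sh * p.ssh * p.qh ^ (d + 1)
  r1_nd : ∀ i : ℕ, 1 ≤ i → i ≤ d → p.r1 * p.q ^ i ≠ 1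
  r2_nd : ∀ i : ℕ, 1 ≤ i → i ≤ d → p.r2 * p.q ^ i ≠ 1
  ssr1_nd : ∀ i : ℕ, 1 ≤ i → i ≤ d → p.ss * p.q ^ i / p.r1 ≠ 1
  ssr2_nd : ∀ i : ℕ, 1 ≤ i → i ≤ d → p.ss * p.q ^ i / p.r2 ≠ 1
  s_nd : ∀ i : ℕ, 2 ≤ i → i ≤ 2 * d → p.s * p.q ^ i ≠ 1
  ss_nd : ∀ i : ℕ, 2 ≤ i → i ≤ 2 * d → p.ss * p.q ^ i ≠ 1

/-- `θ_i = θ_0 + h(1-q^i)(1-sq^{i+1})q^{-i}` -/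
def θ (p : QRacahParams) (i : ℕ) : ℂ :=
  p.θ0 + p.h * (1 - p.q ^ i) * (1 - p.s * p.q ^ (i + 1)) * (p.q ^ i)⁻¹

/-- `θ*_i = θ*_0 + h*(1-q^i)(1-s*q^{i+1})q^{-i}` -/
def θs (p : QRacahParams) (i : ℕ) : ℂ :=
  p.θs0 + p.hs * (1 - p.q ^ i) * (1 - p.ss * p.q ^ (i + 1)) * (p.q ^ i)⁻¹

/-- `φ_i = h h* q^{1-2i}(1-q^i)(1-q^{i-d-1})(1-r_1q^i)(1-r_2q^i)` -/
def φ (p : QRacahParams) (d i : ℕ) : ℂ :=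
  p.h * p.hs * p.q ^ (1 - 2 * (i : ℤ)) * (1 - p.q ^ i) * (1 - p.q ^ ((i : ℤ) - (d : ℤ) - 1)) *
    (1 - p.r1 * p.q ^ i) * (1 - p.r2 * p.q ^ i)

/-- The scalars `k_i` of the Leonard system of diameter `d` with this parameter array. -/
def k (p : QRacahParams) (d i : ℕ) : ℂ := kNum d p.θ p.θs (p.φ d) i

/-- The `q`-Racah parameter array, of diameter two less, of the Leonard system `Φ^⊥`:
`h^⊥ = hq⁻¹`, `s^⊥ = sq²`, `r_j^⊥ = r_jq`, `h*^⊥ = h*q⁻¹`, `s*^⊥ = s*q²`, `θ_0^⊥ = θ_1`,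
`θ*_0^⊥ = θ*_1`. -/
def perp (p : QRacahParams) : QRacahParams where
  qh := p.qh
  sh := p.sh * p.q
  ssh := p.ssh * p.q
  r1h := p.r1h * p.qh
  r2h := p.r2h * p.qh
  h := p.h * p.q⁻¹
  hs := p.hs * p.q⁻¹
  θ0 := p.θ 1
  θs0 := p.θs 1

/-- The same parameter array, viewed as one of `q⁻¹`-Racah type: `q, s, s*, r_1, r_2` are
inverted and `h' = hsq`, `h*' = h*s*q`. -/
def qInv (p : QRacahParams) : QRacahParams where
  qh := p.qh⁻¹
  sh := p.sh⁻¹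
  ssh := p.ssh⁻¹
  r1h := p.r1h⁻¹
  r2h := p.r2h⁻¹
  h := p.h * p.s * p.q
  hs := p.hs * p.ss * p.q
  θ0 := p.θ0
  θs0 := p.θs0

/-- `a = (r_1r_2 / (s*q^D))^{1/2}` -/
def a (p : QRacahParams) (D : ℕ) : ℂ := p.r1h * p.r2h / (p.ssh * p.qh ^ D)

/-- `b = (s* / (r_1r_2q^D))^{1/2}` -/
def b (p : QRacahParams) (D : ℕ) : ℂ := p.ssh / (p.r1h * p.r2h * p.qh ^ D)

/-- `c = (r_2s*q^{D+2} / r_1)^{1/2}` -/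
def c (p : QRacahParams) (D : ℕ) : ℂ := p.r2h * p.ssh * p.qh ^ (D + 2) / p.r1h

/-- `d = (r_1s*q^{D+2} / r_2)^{1/2}` -/
def d (p : QRacahParams) (D : ℕ) : ℂ := p.r1h * p.ssh * p.qh ^ (D + 2) / p.r2h

/-- `ξ_i = q^{1-i}(1-q^{i-D})(1-s*q^{i+1})` (`1 ≤ i ≤ D-1`) -/
def ξ (p : QRacahParams) (D i : ℕ) : ℂ :=
  p.q ^ (1 - (i : ℤ)) * (1 - p.q ^ ((i : ℤ) - (D : ℤ))) * (1 - p.ss * p.q ^ (i + 1))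

/-- `ϵ_i = (1-q^i)(1-s*q^{D+i+1}) / (q^D(1-q^{i-D})(1-s*q^{i+1}))` (`1 ≤ i ≤ D-1`) -/
def ϵ (p : QRacahParams) (D i : ℕ) : ℂ :=
  (1 - p.q ^ i) * (1 - p.ss * p.q ^ (D + i + 1)) /
    (p.q ^ D * (1 - p.q ^ ((i : ℤ) - (D : ℤ))) * (1 - p.ss * p.q ^ (i + 1)))

/-- `p_i(y+y⁻¹; a,b,c,d | q)` -/
def poly (p : QRacahParams) (D i : ℕ) : LaurentPolynomial ℂ :=
  awPoly (p.a D) (p.b D) (p.c D) (p.d D) p.q i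

/-- `p^⊥_i(y+y⁻¹) = p_i(y+y⁻¹; aq,bq,c,d | q)` -/
def polyPerp (p : QRacahParams) (D i : ℕ) : LaurentPolynomial ℂ :=
  awPoly (p.a D * p.q) (p.b D * p.q) (p.c D) (p.d D) p.q i

/-- The Laurent polynomial
`g[y] = β (1-s*q²)(1-s*q³) / ((1-s*q/r_1)(1-s*q/r_2)) · (y - α - β + q^{-D}y⁻¹)`, where
`α = (r_1r_2/(s*q^D))^{1/2}` and `β = (s*/(r_1r_2q^D))^{1/2}`. -/
def g (p : QRacahParams) (D : ℕ) : LaurentPolynomial ℂ :=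
  (p.b D * ((1 - p.ss * p.q ^ 2) * (1 - p.ss * p.q ^ 3) /
      ((1 - p.ss * p.q / p.r1) * (1 - p.ss * p.q / p.r2)))) •
    (LaurentPolynomial.T 1 - LaurentPolynomial.C (p.a D) - LaurentPolynomial.C (p.b D) +
      LaurentPolynomial.C ((p.q ^ D)⁻¹) * LaurentPolynomial.T (-1))

/-- The nonsymmetric Laurent polynomial `ε^+_i` (`0 ≤ i ≤ D-1`): `ε^+_{D-1} = k_D p_D` and
`ε^+_{i-1} = ϵ_i/(ϵ_i-1) k_i p_i + 1/(ξ_i(1-ϵ_i)) k^⊥_{i-1} p^⊥_{i-1} g` for `1 ≤ i ≤ D-1`. -/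
def epsPlus (p : QRacahParams) (D i : ℕ) : LaurentPolynomial ℂ :=
  if i + 1 = D then p.k D D • p.poly D D
  else
    (p.ϵ D (i + 1) / (p.ϵ D (i + 1) - 1) * p.k D (i + 1)) • p.poly D (i + 1) +
      (1 / (p.ξ D (i + 1) * (1 - p.ϵ D (i + 1))) * p.perp.k (D - 2) i) •
        (p.polyPerp D i * p.g D)

/-- The nonsymmetric Laurent polynomial `ε^-_i` (`0 ≤ i ≤ D-1`): `ε^-_0 = 1` and
`ε^-_i = 1/(1-ϵ_i) k_i p_i + 1/(ξ_i(ϵ_i-1)) k^⊥_{i-1} p^⊥_{i-1} g` for `1 ≤ i ≤ D-1`. -/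
def epsMinus (p : QRacahParams) (D i : ℕ) : LaurentPolynomial ℂ :=
  if i = 0 then 1
  else
    (1 / (1 - p.ϵ D i) * p.k D i) • p.poly D i +
      (1 / (p.ξ D i * (p.ϵ D i - 1)) * p.perp.k (D - 2) (i - 1)) •
        (p.polyPerp D (i - 1) * p.g D)

end QRacahParams

end

/-! Replacing `q, s, s*, r₁, r₂` by their inverses (with `h ↦ hsq`, `h* ↦ h*s*q`) leaves the
sequences `θ_i`, `θ*_i`, `φ_i` unchanged, so the scalars `k_i` do not change either. The same holds
for `k^⊥_i`, because passing to the reduced array commutes with the replacement. The Askey-Wilson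
series `p_n` is balanced and hence invariant under inversion of `a, b, c, d, q`. Only `ϵ_i`, `ξ_i`
and `g` change. Since `ab = q^{-D}`, the inverted `g` is a scalar multiple of
`a⁻¹b⁻¹y⁻¹(1-ay)(1-by)`. Thus `p^⊥_{i-1} g` is a multiple of `Q_i`, `p_i` is a multiple of `P_i`,
and the proposition reduces to comparing scalars.

That comparison needs `k_i` in closed form, starting from its definition by idempotents. Normalize
the eigenvectors `w_j` of `A*` to have zeroth coordinate `1`. A difference equation says that `A`
acts on them by a tridiagonal matrix with column sums `θ_0`. Weights `α_j` in detailed balance with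
this matrix give the `θ_0`-eigenvector `∑ α_j w_j` of `A`, so `E*_j u` is proportional to `α_j w_j`,
with a constant independent of `j`, and the intersection numbers can be read off (`kNum_eq_prod`).
For the `q`-Racah family the difference equation is a rational identity
(`IsQRacah.difference_equation`). The product `∏ b_l / c_{l+1}` then telescopes (`k_succ_eq_qPoch`,
`k_top_eq_qPoch`), and `k_smul_poly`, `perp_coeff` and `qInv_perp_term` supply the two summands.

The ends `i = 0` and `i = D` are treated separately: `1 - s*q` and `1 - s*q^{2D+1}` may vanish, so
they have to be cancelled before dividing. -/

noncomputable section

/-! ### Idempotents and eigenvectors of the split matrices -/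

open Matrix in
theorem aeval_mulVec_of_eigenvector {n : ℕ} (B : Matrix (Fin n) (Fin n) ℂ) (v : Fin n → ℂ) (t : ℂ)
    (h : B *ᵥ v = t • v) (f : Polynomial ℂ) : (Polynomial.aeval B f) *ᵥ v = f.eval t • v := by
  induction f using Polynomial.induction_on' with
  | add p r hp hr => simp [Matrix.add_mulVec, hp, hr, add_smul]
  | monomial n a =>
    have hpow : ∀ n : ℕ, (B ^ n) *ᵥ v = t ^ n • v := by
      intro n
      induction n with
      | zero => simp
      | succ n ih => rw [pow_succ, ← Matrix.mulVec_mulVec, h, Matrix.mulVec_smul, ih, smul_smul,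
          pow_succ, mul_comm]
    rw [Polynomial.aeval_monomial, Polynomial.eval_monomial, ← Algebra.smul_def,
      Matrix.smul_mulVec, hpow, smul_smul]

open Matrix in
theorem primIdem_mulVec_of_eigenvector (d : ℕ) (B : Matrix (Fin (d + 1)) (Fin (d + 1)) ℂ)
    (t : ℕ → ℂ) (ht : ∀ i j : Fin (d + 1), t i = t j → i = j) (v : Fin (d + 1) → ℂ)
    (i j : Fin (d + 1)) (h : B *ᵥ v = t j • v) :
    primIdem d B t i *ᵥ v = if i = j then v else 0 := by
  rw [primIdem, aeval_mulVec_of_eigenvector B v _ h, Polynomial.eval_prod]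
  split_ifs with hij
  · subst hij
    rw [Finset.prod_eq_one, one_smul]
    intro k hk
    have : t i - t k ≠ 0 := fun h0 => (Finset.ne_of_mem_erase hk) (ht _ _ (sub_eq_zero.1 h0)).symm
    simp [this]
  · rw [Finset.prod_eq_zero (i := j) (by simp [Ne.symm hij]) (by simp), zero_smul]

theorem splitA_blockTriangular (d : ℕ) (θ : ℕ → ℂ) :
    (splitA d θ).transpose.BlockTriangular id := by
  intro i j hij
  have h : (j : ℕ) < i := hij
  have h1 : j ≠ i := fun e => by simp [e] at h
  simp only [splitA, Matrix.transpose_apply, Matrix.of_apply, if_neg h1]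
  rw [if_neg (by omega)]

theorem charpoly_splitA (d : ℕ) (θ : ℕ → ℂ) :
    (splitA d θ).charpoly = ∏ i : Fin (d + 1), (Polynomial.X - Polynomial.C (θ i)) := by
  rw [← Matrix.charpoly_transpose, Matrix.charpoly_of_isUpperTriangular _ (splitA_blockTriangular d θ)]
  simp [splitA]

open Matrix in
-- Cayley-Hamilton: up to a scalar, `A - θ_i` times the idempotent is the characteristic polynomial
-- evaluated at `A`.
theorem splitA_mulVec_primIdem (d : ℕ) (θ : ℕ → ℂ) (v : Fin (d + 1) → ℂ) (i : Fin (d + 1)) :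
    splitA d θ *ᵥ (primIdem d (splitA d θ) θ i *ᵥ v) = θ i • (primIdem d (splitA d θ) θ i *ᵥ v) := by
  have h0 : Polynomial.aeval (splitA d θ) ((Polynomial.X - Polynomial.C (θ i)) *
      ∏ j ∈ Finset.univ.erase i, (Polynomial.X - Polynomial.C (θ j))) = 0 := by
    rw [Finset.mul_prod_erase Finset.univ (fun j : Fin (d + 1) => Polynomial.X - Polynomial.C (θ j))
      (Finset.mem_univ i), ← charpoly_splitA]
    exact Matrix.aeval_self_charpoly _
  have h1 : (splitA d θ - Polynomial.aeval (splitA d θ) (Polynomial.C (θ i))) *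
      primIdem d (splitA d θ) θ i = 0 := by
    rw [primIdem, Finset.prod_mul_distrib, ← map_prod, mul_comm (Polynomial.C _), map_mul,
      ← mul_assoc]
    rw [map_mul, map_sub, Polynomial.aeval_X] at h0
    rw [h0, zero_mul]
  rw [sub_mul, sub_eq_zero] at h1
  rw [Matrix.mulVec_mulVec, h1, Polynomial.aeval_C, ← Algebra.smul_def, Matrix.smul_mulVec]

open Matrix in
theorem splitA_mulVec_zero (d : ℕ) (θ : ℕ → ℂ) (v : Fin (d + 1) → ℂ) :
    (splitA d θ *ᵥ v) 0 = θ 0 * v 0 := by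
  rw [Matrix.mulVec, dotProduct, Finset.sum_eq_single 0]
  · simp [splitA]
  · intro j _ hj
    have : ¬ (0 : Fin (d + 1)) = j := fun h => hj h.symm
    simp [splitA, this]
  · simp

open Matrix in
theorem splitA_mulVec_succ (d : ℕ) (θ : ℕ → ℂ) (v : Fin (d + 1) → ℂ) (i : ℕ) (hi : i + 1 < d + 1) :
    (splitA d θ *ᵥ v) ⟨i + 1, hi⟩ = θ (i + 1) * v ⟨i + 1, hi⟩ + v ⟨i, by omega⟩ := by
  rw [Matrix.mulVec, dotProduct, Finset.sum_eq_add (⟨i + 1, hi⟩ : Fin (d + 1)) ⟨i, by omega⟩]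
  · simp [splitA]
  · simp
  · intro j _ hj
    have h1 : ¬ (⟨i + 1, hi⟩ : Fin (d + 1)) = j := fun h => hj.1 h.symm
    have h2 : ¬ (i = (j : ℕ)) := fun h => hj.2 (Fin.ext h.symm)
    simp [splitA, h1, h2]
  · simp
  · simp

open Matrix in
theorem aeval_splitA_mulVec_zero (d : ℕ) (θ : ℕ → ℂ) (v : Fin (d + 1) → ℂ) (f : Polynomial ℂ) :
    (Polynomial.aeval (splitA d θ) f *ᵥ v) 0 = f.eval (θ 0) * v 0 := by
  induction f using Polynomial.induction_on' with
  | add p r hp hr => simp [Matrix.add_mulVec, hp, hr, add_mul]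
  | monomial n a =>
    have hpow : ∀ n : ℕ, ((splitA d θ ^ n) *ᵥ v) 0 = θ 0 ^ n * v 0 := by
      intro n
      induction n with
      | zero => simp
      | succ n ih => rw [pow_succ', ← Matrix.mulVec_mulVec, splitA_mulVec_zero, ih, pow_succ]; ring
    rw [Polynomial.aeval_monomial, Polynomial.eval_monomial, ← Algebra.smul_def,
      Matrix.smul_mulVec, Pi.smul_apply, hpow, smul_eq_mul, mul_assoc]

open Matrix in
/-- An eigenvector of the split matrix for `θ 0` is determined by its zeroth coordinate. -/
theorem splitA_eigenvector_unique (d : ℕ) (θ : ℕ → ℂ) (hθ : ∀ i, 1 ≤ i → i ≤ d → θ i ≠ θ 0)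
    (u v : Fin (d + 1) → ℂ) (hu : splitA d θ *ᵥ u = θ 0 • u) (hv : splitA d θ *ᵥ v = θ 0 • v)
    (h0 : u 0 = v 0) : u = v := by
  have key : ∀ i : ℕ, ∀ hi : i < d + 1, u ⟨i, hi⟩ = v ⟨i, hi⟩ := by
    intro i
    induction i with
    | zero => intro _; exact h0
    | succ i ih =>
      intro hi
      have h1 := congrFun hu ⟨i + 1, hi⟩
      have h2 := congrFun hv ⟨i + 1, hi⟩
      rw [splitA_mulVec_succ, Pi.smul_apply, smul_eq_mul] at h1 h2
      have h3 := ih (by omega)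
      have h4 : θ (i + 1) - θ 0 ≠ 0 := sub_ne_zero.2 (hθ _ (by omega) (by omega))
      apply mul_left_cancel₀ h4
      linear_combination h1 - h2 - h3
  exact funext fun i => key i i.2

open Matrix in
theorem splitAstar_mulVec (d : ℕ) (θs φ : ℕ → ℂ) (w : ℕ → ℂ) (i : Fin (d + 1)) :
    (splitAstar d θs φ *ᵥ fun k => w k) i =
      θs i * w i + if (i : ℕ) = d then 0 else φ (i + 1) * w (i + 1) := by
  have : ∀ k : Fin (d + 1), splitAstar d θs φ i k * w k =
      (if (k : ℕ) = i then θs i * w i else 0) +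
        if (k : ℕ) = (i : ℕ) + 1 then φ (i + 1) * w (i + 1) else 0 := by
    intro k
    by_cases h : (k : ℕ) = i
    · have : i = k := Fin.ext h.symm
      subst this
      simp [splitAstar]
    · have h' : ¬ i = k := fun e => h (by rw [e])
      by_cases h2 : (k : ℕ) = (i : ℕ) + 1
      · simp [splitAstar, h', h2]
      · simp [splitAstar, h', h2, h]
  rw [Matrix.mulVec, dotProduct, Finset.sum_congr rfl fun k _ => this k, Finset.sum_add_distrib]
  congr 1
  · simp [← Fin.ext_iff]
  · rw [Fin.sum_univ_eq_sum_range (fun k => if k = (i : ℕ) + 1 then φ (i + 1) * w (i + 1) else 0),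
      Finset.sum_ite_eq']
    have := i.2
    by_cases h : (i : ℕ) = d
    · simp [h]
    · rw [if_neg h, if_pos (by simp; omega)]

/-- Coordinates of the eigenvectors of the upper bidiagonal split matrix, normalized at `0`. -/
def splitEigvec (θs φ : ℕ → ℂ) (j i : ℕ) : ℂ :=
  ∏ l ∈ Finset.range i, (θs j - θs l) / φ (l + 1)

theorem splitEigvec_zero (θs φ : ℕ → ℂ) (j : ℕ) : splitEigvec θs φ j 0 = 1 := by
  simp [splitEigvec]

theorem splitEigvec_succ (θs φ : ℕ → ℂ) (j i : ℕ) :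
    splitEigvec θs φ j (i + 1) = splitEigvec θs φ j i * ((θs j - θs i) / φ (i + 1)) :=
  Finset.prod_range_succ _ _

theorem splitEigvec_eq_zero (θs φ : ℕ → ℂ) {j i : ℕ} (h : j < i) : splitEigvec θs φ j i = 0 :=
  Finset.prod_eq_zero (Finset.mem_range.2 h) (by simp)

open Matrix in
theorem splitAstar_mulVec_splitEigvec (d : ℕ) (θs φ : ℕ → ℂ)
    (hφ : ∀ i, 1 ≤ i → i ≤ d → φ i ≠ 0) (j : Fin (d + 1)) :
    (splitAstar d θs φ *ᵥ fun k : Fin (d + 1) => splitEigvec θs φ j k) =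
      θs j • fun k : Fin (d + 1) => splitEigvec θs φ j k := by
  funext i
  rw [splitAstar_mulVec d θs φ (splitEigvec θs φ j), Pi.smul_apply, smul_eq_mul]
  split_ifs with h
  -- The last row has no superdiagonal entry. Either `j = d`, or the last coordinate of `w_j`
  -- vanishes.
  · by_cases hj : j = i
    · rw [hj, add_zero]
    · have h1 := j.2
      have h2 : (j : ℕ) ≠ i := fun e => hj (Fin.ext e)
      rw [splitEigvec_eq_zero θs φ (show (j : ℕ) < i by omega)]; simp
  · have h1 := i.2
    have := hφ (i + 1) (by omega) (by omega)
    rw [splitEigvec_succ]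
    field_simp
    ring

/-! ### Intersection numbers from a tridiagonal action -/

/-- The tridiagonal matrix with superdiagonal `c`, subdiagonal `b` and column sums `t`. -/
def tridiagEntry (t : ℂ) (b c : ℕ → ℂ) (l j : ℕ) : ℂ :=
  (if l = j - 1 then c j else 0) + (if l = j then t - b j - c j else 0) +
    (if l = j + 1 then b j else 0)

/-- The boundary is harmless: at `j = 0` truncated subtraction gives `j - 1 = 0` and `c 0` cancels,
while `b d = 0` removes the out-of-range term at `j = d`. -/
theorem sum_mul_tridiagEntry (d : ℕ) (t : ℂ) (b c f : ℕ → ℂ) (hb : b d = 0) (j : ℕ) (hj : j ≤ d) :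
    ∑ l : Fin (d + 1), f l * tridiagEntry t b c l j =
      f (j - 1) * c j + f j * (t - b j - c j) + f (j + 1) * b j := by
  rw [Fin.sum_univ_eq_sum_range (fun l => f l * tridiagEntry t b c l j)]
  simp only [tridiagEntry, mul_add, Finset.sum_add_distrib, mul_ite, mul_zero, Finset.sum_ite_eq']
  rw [if_pos (by simp; omega), if_pos (by simp; omega)]
  split_ifs with h
  · rfl
  · have : j = d := by simp at h; omega
    rw [this, hb, mul_zero]

/-- Detailed balance makes the matrix symmetric after weighting by `f`, so a weighted row sum
becomes `f l` times a column sum, which is `t`. -/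
theorem sum_tridiagEntry_mul (d : ℕ) (t : ℂ) (b c f : ℕ → ℂ) (hb : b d = 0)
    (hbc : ∀ j < d, f j * b j = f (j + 1) * c (j + 1))
    (l : ℕ) (hl : l ≤ d) :
    ∑ j : Fin (d + 1), tridiagEntry t b c l j * f j = t * f l := by
  have h1 : ∀ j ≤ d, tridiagEntry t b c l j * f j = f l * tridiagEntry t b c j l := by
    intro j hj
    unfold tridiagEntry
    rcases lt_trichotomy l j with h | h | h
    · by_cases h' : j = l + 1
      · have := hbc l (by omega)
        rw [h']
        have e : l ≠ l + 1 + 1 := by omega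
        have e2 : l + 1 ≠ l - 1 := by omega
        simp only [Nat.add_sub_cancel, if_true, if_neg e, if_neg e2, if_neg (Nat.succ_ne_self l),
          if_neg (Nat.succ_ne_self l).symm]
        linear_combination -this
      · rw [if_neg (by omega), if_neg (by omega), if_neg (by omega), if_neg (by omega),
          if_neg (by omega), if_neg (by omega)]
        simp
    · rw [h]; ring
    · by_cases h' : l = j + 1
      · have := hbc j (by omega)
        rw [h']
        have e : j ≠ j + 1 + 1 := by omega
        have e2 : j + 1 ≠ j - 1 := by omega
        simp only [Nat.add_sub_cancel, if_true, if_neg e, if_neg e2, if_neg (Nat.succ_ne_self j),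
          if_neg (Nat.succ_ne_self j).symm]
        linear_combination this
      · rw [if_neg (by omega), if_neg (by omega), if_neg (by omega), if_neg (by omega),
          if_neg (by omega), if_neg (by omega)]
        simp
  have h2 : ∀ j : Fin (d + 1), tridiagEntry t b c l j * f j = f l * tridiagEntry t b c j l :=
    fun j => h1 j (by omega)
  rw [Finset.sum_congr rfl fun j _ => h2 j, ← Finset.mul_sum]
  have := sum_mul_tridiagEntry d t b c (fun _ => 1) hb l hl
  simp only [one_mul] at this
  rw [this]; ring

open Matrix in
/-- Intersection numbers are determined by the difference equation that they induce on the
normalized eigenvectors of the dual split matrix. -/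
theorem kNum_eq_prod (d : ℕ) (θ θs φ b c : ℕ → ℂ)
    (hθ : ∀ i, 1 ≤ i → i ≤ d → θ i ≠ θ 0)
    (hθ' : ∀ i j : Fin (d + 1), θs i = θs j → i = j)
    (hφ : ∀ i, 1 ≤ i → i ≤ d → φ i ≠ 0)
    (hbd : b d = 0) (hb : ∀ i < d, b i ≠ 0) (hc : ∀ i, 1 ≤ i → i ≤ d → c i ≠ 0)
    (hw : ∀ i j, i < d → j ≤ d →
      (θ (i + 1) - θ 0) * splitEigvec θs φ j (i + 1) + splitEigvec θs φ j i =
        c j * (splitEigvec θs φ (j - 1) (i + 1) - splitEigvec θs φ j (i + 1)) +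
        b j * (splitEigvec θs φ (j + 1) (i + 1) - splitEigvec θs φ j (i + 1)))
    (i : ℕ) (hi : i ≤ d) :
    kNum d θ θs φ i = ∏ l ∈ Finset.range i, b l / c (l + 1) := by
  -- The solution of the detailed balance equations with `α 0 = 1`.
  set α : ℕ → ℂ := fun i => ∏ l ∈ Finset.range i, b l / c (l + 1) with hα
  set w := splitEigvec θs φ with hw_def
  have hαs : ∀ j < d, α j * b j = α (j + 1) * c (j + 1) := by
    intro j hj
    have := hc (j + 1) (by omega) (by omega)
    simp only [hα, Finset.prod_range_succ]
    field_simp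
  have hα0 : ∀ j ≤ d, α j ≠ 0 := by
    intro j hj
    refine Finset.prod_ne_zero_iff.2 fun l hl => ?_
    have := Finset.mem_range.1 hl
    exact div_ne_zero (hb l (by omega)) (hc _ (by omega) (by omega))
  let W : Matrix (Fin (d + 1)) (Fin (d + 1)) ℂ := Matrix.of fun i j => w j i
  let T : Matrix (Fin (d + 1)) (Fin (d + 1)) ℂ := Matrix.of fun l j => tridiagEntry (θ 0) b c l j
  have hAW : splitA d θ * W = W * T := by
    ext ⟨i, hi⟩ ⟨j, hj⟩
    have e1 : (W * T) ⟨i, hi⟩ ⟨j, hj⟩ =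
        w (j - 1) i * c j + w j i * (θ 0 - b j - c j) + w (j + 1) i * b j := by
      rw [Matrix.mul_apply]
      exact sum_mul_tridiagEntry d (θ 0) b c (fun l => w l i) hbd j (by omega)
    have e2 : (splitA d θ * W) ⟨i, hi⟩ ⟨j, hj⟩ =
      (splitA d θ *ᵥ fun k => W k ⟨j, hj⟩) ⟨i, hi⟩ := rfl
    rw [e1, e2]
    cases i with
    -- All `w_j` have zeroth coordinate `1`, so row zero says only that the columns of `T` sum to `θ
    -- 0`.
    | zero =>
      have : (⟨0, hi⟩ : Fin (d + 1)) = 0 := rfl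
      rw [this, splitA_mulVec_zero]
      simp [W, hw_def, splitEigvec_zero]
    | succ i =>
      rw [splitA_mulVec_succ]
      have := hw i j (by omega) (by omega)
      simp only [W, Matrix.of_apply]
      linear_combination this
  have hWdet : W.det ≠ 0 := by
    have hW : W.BlockTriangular id := by
      intro i j hij
      exact splitEigvec_eq_zero θs φ hij
    rw [Matrix.det_of_isUpperTriangular hW]
    refine Finset.prod_ne_zero_iff.2 fun j _ => ?_
    change splitEigvec θs φ j j ≠ 0
    refine Finset.prod_ne_zero_iff.2 fun l hl => ?_
    have hl' := Finset.mem_range.1 hl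
    have hj := j.2
    refine div_ne_zero (sub_ne_zero.2 fun h => ?_) (hφ _ (by omega) (by omega))
    have := hθ' j ⟨l, by omega⟩ h
    rw [this] at hl'
    exact lt_irrefl _ hl'
  let av : Fin (d + 1) → ℂ := fun j => α j
  have hTα : T *ᵥ av = θ 0 • av := by
    funext l
    exact sum_tridiagEntry_mul d (θ 0) b c α hbd hαs l (by omega)
  set u' := W *ᵥ av with hu'
  have hAu' : splitA d θ *ᵥ u' = θ 0 • u' := by
    rw [hu', Matrix.mulVec_mulVec, hAW, ← Matrix.mulVec_mulVec, hTα, Matrix.mulVec_smul]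
  set u := primIdem d (splitA d θ) θ 0 *ᵥ (Pi.single 0 1) with hu
  have hAu : splitA d θ *ᵥ u = θ 0 • u := splitA_mulVec_primIdem d θ _ 0
  have hu0 : u 0 = 1 := by
    rw [hu, primIdem, aeval_splitA_mulVec_zero, Polynomial.eval_prod, Finset.prod_eq_one]
    · simp
    · intro k hk
      have hk0 := Finset.ne_of_mem_erase hk
      have : (k : ℕ) ≠ 0 := fun h => hk0 (Fin.ext h)
      have : θ 0 - θ k ≠ 0 := fun h => hθ k (by omega) (by omega) (sub_eq_zero.1 h).symm
      simp [this]
  -- A `θ 0`-eigenvector with zeroth coordinate `0` vanishes, which is impossible here since `W` is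
  -- invertible and `α 0 ≠ 0`.
  have hu'0 : u' 0 ≠ 0 := by
    intro h
    have h1 : u' = 0 := splitA_eigenvector_unique d θ hθ u' 0 hAu' (by simp) (by simp [h])
    have h2 : av = 0 := Matrix.eq_zero_of_mulVec_eq_zero hWdet h1
    exact hα0 0 (by omega) (congrFun h2 0)
  have huu : u = (u' 0)⁻¹ • u' := by
    refine splitA_eigenvector_unique d θ hθ _ _ hAu ?_ ?_
    · rw [Matrix.mulVec_smul, hAu', smul_comm]
    · simp [hu0, hu'0]
  have hS : stdBasisMatrix d θ θs φ = (u' 0)⁻¹ • (W * Matrix.diagonal av) := by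
    ext i j
    have e : u' = ∑ l : Fin (d + 1), α l • fun k : Fin (d + 1) => w l k := by
      funext k
      simp [hu', Matrix.mulVec, dotProduct, W, av, mul_comm]
    have : primIdem d (splitAstar d θs φ) θs j *ᵥ u' = α j • fun k : Fin (d + 1) => w j k := by
      rw [e, Matrix.mulVec_sum, Finset.sum_eq_single j]
      · rw [Matrix.mulVec_smul, primIdem_mulVec_of_eigenvector d _ θs hθ' _ j j
          (splitAstar_mulVec_splitEigvec d θs φ hφ j), if_pos rfl]
      · intro l _ hl
        rw [Matrix.mulVec_smul, primIdem_mulVec_of_eigenvector d _ θs hθ' _ j l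
          (splitAstar_mulVec_splitEigvec d θs φ hφ l), if_neg (Ne.symm hl), smul_zero]
      · simp
    rw [stdBasisMatrix, Matrix.of_apply]
    change (primIdem d (splitAstar d θs φ) θs j *ᵥ u) i = _
    rw [huu, Matrix.mulVec_smul, this]
    simp [Matrix.mul_diagonal, W, av, mul_comm]
  have hav : ∀ j, av j ≠ 0 := fun j => hα0 j (by omega)
  have hdet : IsUnit (stdBasisMatrix d θ θs φ).det := by
    rw [hS, Matrix.det_smul, Matrix.det_mul, Matrix.det_diagonal, isUnit_iff_ne_zero]
    exact mul_ne_zero (pow_ne_zero _ (inv_ne_zero hu'0))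
      (mul_ne_zero hWdet (Finset.prod_ne_zero_iff.2 fun j _ => hav j))
  -- Rescaling the basis `w_j` by `α j` conjugates `T` by a diagonal matrix. By detailed balance
  -- this moves `b` to the superdiagonal and `c` to the subdiagonal.
  have hM : intersectionMatrix d θ θs φ =
      Matrix.diagonal (fun j => (av j)⁻¹) * T * Matrix.diagonal av := by
    have hdiag : Matrix.diagonal av * Matrix.diagonal (fun j => (av j)⁻¹) = 1 := by
      rw [Matrix.diagonal_mul_diagonal]
      simp [hav]
    have : splitA d θ * stdBasisMatrix d θ θs φ = stdBasisMatrix d θ θs φ *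
        (Matrix.diagonal (fun j => (av j)⁻¹) * T * Matrix.diagonal av) := by
      rw [hS, Matrix.mul_smul, Matrix.smul_mul, ← Matrix.mul_assoc, hAW]
      congr 1
      calc W * T * diagonal av = W * 1 * T * diagonal av := by rw [Matrix.mul_one]
        _ = _ := by rw [← hdiag]; simp only [Matrix.mul_assoc]
    rw [intersectionMatrix, Matrix.mul_assoc, this, ← Matrix.mul_assoc,
      Matrix.nonsing_inv_mul _ hdet, Matrix.one_mul]
  have hMe : ∀ l j, l ≤ d → j ≤ d → intersectionMatrix d θ θs φ (Fin.ofNat (d + 1) l)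
      (Fin.ofNat (d + 1) j) = (α l)⁻¹ * tridiagEntry (θ 0) b c l j * α j := by
    intro l j hl hj
    rw [hM, Matrix.mul_diagonal, Matrix.diagonal_mul]
    simp [T, av, Fin.ofNat, Nat.mod_eq_of_lt (Nat.lt_succ_of_le hl),
      Nat.mod_eq_of_lt (Nat.lt_succ_of_le hj)]
  have hbN : ∀ l < d, bNum d θ θs φ l = b l := by
    intro l hl
    rw [bNum, hMe l (l + 1) (by omega) (by omega)]
    have := hαs l hl
    have h0 := hα0 l (by omega)
    simp only [tridiagEntry, Nat.add_sub_cancel, if_true]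
    rw [if_neg (by omega), if_neg (by omega)]
    field_simp
    linear_combination -this
  have hcN : ∀ l < d, cNum d θ θs φ (l + 1) = c (l + 1) := by
    intro l hl
    rw [cNum, hMe (l + 1) (l + 1 - 1) (by omega) (by omega)]
    have := hαs l hl
    have h0 := hα0 (l + 1) (by omega)
    simp only [tridiagEntry, Nat.add_sub_cancel, if_true]
    rw [if_neg (by omega), if_neg (by omega)]
    field_simp
    linear_combination this
  rw [kNum, ← Finset.prod_div_distrib]
  refine Finset.prod_congr rfl fun l hl => ?_
  have := Finset.mem_range.1 hl
  rw [hbN l (by omega), hcN l (by omega)]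

/-! ### Rational identities behind the q-Racah difference equation -/

/-- Throughout, `x = q^n`, `y = q^j`, `Q = q^D` and `S = s*`. This is `w_{j-1}(n+1) - w_j(n+1)` in
units of `h* w_j(n) / φ_{n+1}`. The factor `1 - S y²` cancels a denominator of `c_j`. -/
theorem racah_down_sub (q x y S : ℂ) (hx : x ≠ 0) (hy : y ≠ 0) (hy1 : 1 - y ≠ 0) :
    (1 / y - 1 / x) * (q / y - 1 / x) * x * (1 - S * y) / (1 / y - 1) -
        (1 / y - 1 / x) * (1 - S * y * x * q) =
      (x - y) * (q * x - 1) * (1 - S * y ^ 2) / (x * y * (1 - y)) := by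
  have : 1 / y - 1 = (1 - y) / y := by field_simp
  rw [this, div_div_eq_mul_div]
  field_simp
  ring

theorem racah_up_sub (q x y S : ℂ) (hq : q ≠ 0) (hx : x ≠ 0) (hy : y ≠ 0)
    (h3 : 1 - S * q * y ≠ 0) :
    (1 / (q * y) - 1) / x * (1 - S * q * x * y) * (1 - S * q ^ 2 * x * y) / (1 - S * q * y) -
        (1 / y - 1 / x) * (1 - S * y * x * q) =
      (1 - S * q * x * y) * (1 - q * x) * (1 - S * q ^ 2 * y ^ 2) /
        (q * x * y * (1 - S * q * y)) := by
  obtain ⟨z, hz⟩ : ∃ z, z = 1 - S * q * y := ⟨_, rfl⟩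
  rw [← hz] at h3 ⊢
  field_simp
  rw [hz]
  ring

/-- What remains of the difference equation once both differences are factored and the common `h h*
(1 - qx)` is removed; `1 - S q y²` is the only composite denominator left. -/
theorem racah_reduced (q x y Q S r1 r2 : ℂ) (hq : q ≠ 0) (hx : x ≠ 0) (hy : y ≠ 0)
    (hQ : Q ≠ 0) (hS : S ≠ 0) (h1 : 1 - S * q * y ^ 2 ≠ 0) :
    (1 - r1 * r2 / (S * Q * q) * q ^ 2 * x) / (q * x) *
        ((1 / y - 1 / x) * (1 - S * y * x * q)) +
      1 / (q * x ^ 2) * (1 - x / Q) * (1 - r1 * q * x) * (1 - r2 * q * x) =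
    (1 - y / Q) * (1 - r1 * q * y) * (1 - r2 * q * y) * (1 - S * q * x * y) /
        (q * x * y * (1 - S * q * y ^ 2)) -
      (x - y) * (1 - S * y * Q * q) * (r1 - S * y) * (r2 - S * y) /
        (x * y * S * Q * (1 - S * q * y ^ 2)) := by
  field_simp
  ring

theorem racah_difference_generic (q x y Q S r1 r2 h hs : ℂ) (hq : q ≠ 0) (hx : x ≠ 0) (hy : y ≠ 0)
    (hQ : Q ≠ 0) (hS : S ≠ 0) (hy1 : 1 - y ≠ 0) (h0 : 1 - S * y ^ 2 ≠ 0)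
    (h1 : 1 - S * q * y ^ 2 ≠ 0) (h2 : 1 - S * q ^ 2 * y ^ 2 ≠ 0) (h3 : 1 - S * q * y ≠ 0) :
    h * (1 - q * x) * (1 - r1 * r2 / (S * Q * q) * q ^ 2 * x) / (q * x) *
        (hs * (1 / y - 1 / x) * (1 - S * y * x * q)) +
      h * hs / (q * x ^ 2) * (1 - q * x) * (1 - x / Q) * (1 - r1 * q * x) * (1 - r2 * q * x) =
    h * (1 - y) * (1 - S * y * Q * q) * (r1 - S * y) * (r2 - S * y) /
        (S * Q * (1 - S * y ^ 2) * (1 - S * q * y ^ 2)) *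
      (hs * (1 / y - 1 / x) * (q / y - 1 / x) * x * (1 - S * y) / (1 / y - 1) -
        hs * (1 / y - 1 / x) * (1 - S * y * x * q)) +
    h * (1 - y / Q) * (1 - S * q * y) * (1 - r1 * q * y) * (1 - r2 * q * y) /
        ((1 - S * q * y ^ 2) * (1 - S * q ^ 2 * y ^ 2)) *
      (hs * (1 / (q * y) - 1) / x * (1 - S * q * x * y) * (1 - S * q ^ 2 * x * y) / (1 - S * q * y) -
        hs * (1 / y - 1 / x) * (1 - S * y * x * q)) := by
  have e1 := racah_down_sub q x y S hx hy hy1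
  have e2 := racah_up_sub q x y S hq hx hy h3
  have e3 := racah_reduced q x y Q S r1 r2 hq hx hy hQ hS h1
  have e4 : h * (1 - y) * (1 - S * y * Q * q) * (r1 - S * y) * (r2 - S * y) /
        (S * Q * (1 - S * y ^ 2) * (1 - S * q * y ^ 2)) *
      (hs * ((x - y) * (q * x - 1) * (1 - S * y ^ 2) / (x * y * (1 - y)))) =
      h * hs * (q * x - 1) * ((x - y) * (1 - S * y * Q * q) * (r1 - S * y) * (r2 - S * y) /
        (x * y * S * Q * (1 - S * q * y ^ 2))) := by
    generalize 1 - S * y ^ 2 = u at h0 ⊢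
    generalize 1 - S * q * y ^ 2 = v at h1 ⊢
    field_simp
  have e5 : h * (1 - y / Q) * (1 - S * q * y) * (1 - r1 * q * y) * (1 - r2 * q * y) /
        ((1 - S * q * y ^ 2) * (1 - S * q ^ 2 * y ^ 2)) *
      (hs * ((1 - S * q * x * y) * (1 - q * x) * (1 - S * q ^ 2 * y ^ 2) /
        (q * x * y * (1 - S * q * y)))) = h * hs * (1 - q * x) *
      ((1 - y / Q) * (1 - r1 * q * y) * (1 - r2 * q * y) * (1 - S * q * x * y) /
        (q * x * y * (1 - S * q * y ^ 2))) := by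
    generalize 1 - y / Q = z
    generalize 1 - S * q * y ^ 2 = u at h1 ⊢
    generalize 1 - S * q ^ 2 * y ^ 2 = v at h2 ⊢
    generalize 1 - S * q * y = w at h3 ⊢
    field_simp
  rw [← e1] at e4
  rw [← e2] at e5
  linear_combination h * hs * (1 - q * x) * e3 - e4 - e5

/-- The case `y = Q`, where `b_D = 0`. In `c_D` the factor `1 - S y Q q` of the numerator equals the
factor `1 - S q y²` of the denominator. It may vanish, so it is cancelled from the outset. -/
theorem racah_difference_top (q x Q S r1 r2 h hs : ℂ) (hq : q ≠ 0) (hx : x ≠ 0)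
    (hQ : Q ≠ 0) (hS : S ≠ 0) (hy1 : 1 - Q ≠ 0) (h0 : 1 - S * Q ^ 2 ≠ 0) :
    h * (1 - q * x) * (1 - r1 * r2 / (S * Q * q) * q ^ 2 * x) / (q * x) *
        (hs * (1 / Q - 1 / x) * (1 - S * Q * x * q)) +
      h * hs / (q * x ^ 2) * (1 - q * x) * (1 - x / Q) * (1 - r1 * q * x) * (1 - r2 * q * x) =
    h * (1 - Q) * (r1 - S * Q) * (r2 - S * Q) / (S * Q * (1 - S * Q ^ 2)) *
      (hs * (1 / Q - 1 / x) * (q / Q - 1 / x) * x * (1 - S * Q) / (1 / Q - 1) -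
        hs * (1 / Q - 1 / x) * (1 - S * Q * x * q)) := by
  have e : (1 / Q - 1 / x) * (q / Q - 1 / x) * x * (1 - S * Q) / (1 / Q - 1) =
      (1 / Q - 1 / x) * (q / Q - 1 / x) * x * (1 - S * Q) * Q / (1 - Q) := by
    have : 1 / Q - 1 = (1 - Q) / Q := by field_simp
    rw [this, div_div_eq_mul_div]
  rw [show hs * (1 / Q - 1 / x) * (q / Q - 1 / x) * x * (1 - S * Q) / (1 / Q - 1) =
    hs * ((1 / Q - 1 / x) * (q / Q - 1 / x) * x * (1 - S * Q) / (1 / Q - 1)) by ring, e]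
  field_simp
  ring

/-! ### Intersection numbers of the q-Racah family -/

namespace QRacahParams

/-- The intersection numbers `b_i` of a `q`-Racah system of diameter `D`. -/
def racahB (p : QRacahParams) (D i : ℕ) : ℂ :=
  if i = 0 then p.h * (1 - 1 / p.q ^ D) * (1 - p.r1 * p.q) * (1 - p.r2 * p.q) / (1 - p.ss * p.q ^ 2)
  else p.h * (1 - p.q ^ i / p.q ^ D) * (1 - p.ss * p.q * p.q ^ i) * (1 - p.r1 * p.q * p.q ^ i) *
      (1 - p.r2 * p.q * p.q ^ i) /
        ((1 - p.ss * p.q * (p.q ^ i) ^ 2) * (1 - p.ss * p.q ^ 2 * (p.q ^ i) ^ 2))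

/-- The intersection numbers `c_i` of a `q`-Racah system of diameter `D`. -/
def racahC (p : QRacahParams) (D i : ℕ) : ℂ :=
  if i = D then p.h * (1 - p.q ^ D) * (p.r1 - p.ss * p.q ^ D) * (p.r2 - p.ss * p.q ^ D) /
      (p.ss * p.q ^ D * (1 - p.ss * (p.q ^ D) ^ 2))
  else p.h * (1 - p.q ^ i) * (1 - p.ss * p.q ^ i * p.q ^ D * p.q) * (p.r1 - p.ss * p.q ^ i) *
      (p.r2 - p.ss * p.q ^ i) /
        (p.ss * p.q ^ D * (1 - p.ss * (p.q ^ i) ^ 2) * (1 - p.ss * p.q * (p.q ^ i) ^ 2))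

namespace IsQRacah

variable {p : QRacahParams} {D : ℕ}

theorem q_ne (hp : p.IsQRacah D) : p.q ≠ 0 := pow_ne_zero _ hp.qh_ne
theorem s_ne (hp : p.IsQRacah D) : p.s ≠ 0 := pow_ne_zero _ hp.sh_ne
theorem ss_ne (hp : p.IsQRacah D) : p.ss ≠ 0 := pow_ne_zero _ hp.ssh_ne
theorem r1_ne (hp : p.IsQRacah D) : p.r1 ≠ 0 := pow_ne_zero _ hp.r1h_ne
theorem r2_ne (hp : p.IsQRacah D) : p.r2 ≠ 0 := pow_ne_zero _ hp.r2h_ne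
theorem qpow_ne (hp : p.IsQRacah D) (i : ℕ) : p.q ^ i ≠ 0 := pow_ne_zero _ hp.q_ne

theorem s_eq (hp : p.IsQRacah D) : p.s = p.r1 * p.r2 / (p.ss * p.q ^ D * p.q) := by
  have h1 := hp.ss_ne
  have h2 := hp.q_ne
  have h := congrArg (· ^ 2) hp.r_mul
  rw [eq_div_iff (by positivity)]
  simp only [s, ss, r1, r2, q] at *
  linear_combination -h

theorem one_sub_qpow_ne (hp : p.IsQRacah D) {i : ℕ} (hi : 1 ≤ i) : 1 - p.q ^ i ≠ 0 :=
  sub_ne_zero.2 (hp.q_not_root i hi).symm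

theorem one_sub_ss_ne (hp : p.IsQRacah D) {i : ℕ} (h1 : 2 ≤ i) (h2 : i ≤ 2 * D) :
    1 - p.ss * p.q ^ i ≠ 0 :=
  sub_ne_zero.2 (hp.ss_nd i h1 h2).symm

theorem one_sub_s_ne (hp : p.IsQRacah D) {i : ℕ} (h1 : 2 ≤ i) (h2 : i ≤ 2 * D) :
    1 - p.s * p.q ^ i ≠ 0 :=
  sub_ne_zero.2 (hp.s_nd i h1 h2).symm

theorem one_sub_r1_ne (hp : p.IsQRacah D) {i : ℕ} (h1 : 1 ≤ i) (h2 : i ≤ D) :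
    1 - p.r1 * p.q ^ i ≠ 0 :=
  sub_ne_zero.2 (hp.r1_nd i h1 h2).symm

theorem one_sub_r2_ne (hp : p.IsQRacah D) {i : ℕ} (h1 : 1 ≤ i) (h2 : i ≤ D) :
    1 - p.r2 * p.q ^ i ≠ 0 :=
  sub_ne_zero.2 (hp.r2_nd i h1 h2).symm

theorem r1_sub_ne (hp : p.IsQRacah D) {i : ℕ} (h1 : 1 ≤ i) (h2 : i ≤ D) :
    p.r1 - p.ss * p.q ^ i ≠ 0 := by
  refine sub_ne_zero.2 fun h => hp.ssr1_nd i h1 h2 ?_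
  rw [← h, div_self hp.r1_ne]

theorem r2_sub_ne (hp : p.IsQRacah D) {i : ℕ} (h1 : 1 ≤ i) (h2 : i ≤ D) :
    p.r2 - p.ss * p.q ^ i ≠ 0 := by
  refine sub_ne_zero.2 fun h => hp.ssr2_nd i h1 h2 ?_
  rw [← h, div_self hp.r2_ne]

theorem qpow_sub_ne (hp : p.IsQRacah D) {i j : ℕ} (h : i ≠ j) : p.q ^ i - p.q ^ j ≠ 0 := by
  have key : ∀ i j : ℕ, i < j → p.q ^ i - p.q ^ j ≠ 0 := by
    intro i j hij
    obtain ⟨k, rfl⟩ := Nat.exists_eq_add_of_lt hij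
    have := mul_ne_zero (hp.qpow_ne i) (hp.one_sub_qpow_ne (i := k + 1) (by omega))
    intro h
    apply this
    rw [← h]; ring
  rcases lt_or_gt_of_ne h with h | h
  · exact key _ _ h
  · intro h'
    exact key _ _ h (by linear_combination -h')

theorem θs_sub (hp : p.IsQRacah D) (i j : ℕ) :
    p.θs i - p.θs j = p.hs * (1 / p.q ^ i - 1 / p.q ^ j) * (1 - p.ss * p.q ^ i * p.q ^ j * p.q) := by
  have h1 := hp.qpow_ne i
  have h2 := hp.qpow_ne j
  simp only [θs, pow_succ]
  field_simp
  ring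

theorem _root_.QRacahParams.θ_sub (p : QRacahParams) (i : ℕ) :
    p.θ i - p.θ 0 = p.h * (1 - p.q ^ i) * (1 - p.s * p.q ^ (i + 1)) / p.q ^ i := by
  simp [θ, div_eq_mul_inv]

theorem φ_succ (hp : p.IsQRacah D) (n : ℕ) :
    p.φ D (n + 1) = p.h * p.hs / (p.q * (p.q ^ n) ^ 2) * (1 - p.q * p.q ^ n) *
      (1 - p.q ^ n / p.q ^ D) * (1 - p.r1 * p.q * p.q ^ n) * (1 - p.r2 * p.q * p.q ^ n) := by
  have e1 : p.q ^ (1 - 2 * ((n + 1 : ℕ) : ℤ)) = 1 / (p.q * (p.q ^ n) ^ 2) := by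
    rw [show (1 - 2 * ((n + 1 : ℕ) : ℤ)) = -((1 + n * 2 : ℕ) : ℤ) by push_cast; ring, zpow_neg,
      zpow_natCast, pow_add, pow_mul, pow_one, one_div]
  have e2 : p.q ^ (((n + 1 : ℕ) : ℤ) - (D : ℤ) - 1) = p.q ^ n / p.q ^ D := by
    rw [show (((n + 1 : ℕ) : ℤ) - (D : ℤ) - 1) = (n : ℤ) - (D : ℤ) by push_cast; ring,
      zpow_sub₀ hp.q_ne, zpow_natCast, zpow_natCast]
  rw [φ, e1, e2, pow_succ]
  ring

theorem one_sub_div_ne (hp : p.IsQRacah D) {i : ℕ} (h : i ≠ D) : 1 - p.q ^ i / p.q ^ D ≠ 0 := by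
  have h1 := hp.qpow_ne D
  have h2 := hp.qpow_sub_ne (Ne.symm h)
  intro h0
  apply h2
  field_simp at h0
  linear_combination h0

theorem φ_ne (hp : p.IsQRacah D) (i : ℕ) (h1 : 1 ≤ i) (h2 : i ≤ D) : p.φ D i ≠ 0 := by
  obtain ⟨n, rfl⟩ : ∃ n, i = n + 1 := ⟨i - 1, by omega⟩
  rw [hp.φ_succ]
  have e1 := hp.one_sub_qpow_ne h1
  have e2 := hp.one_sub_div_ne (i := n) (by omega)
  have e3 := hp.one_sub_r1_ne h1 h2
  have e4 := hp.one_sub_r2_ne h1 h2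
  rw [pow_succ'] at e1 e3 e4
  rw [← mul_assoc] at e3 e4
  have := hp.h_ne
  have := hp.hs_ne
  have := hp.q_ne
  have := hp.qpow_ne n
  simp [*]

theorem θ_ne (hp : p.IsQRacah D) (i : ℕ) (h1 : 1 ≤ i) (h2 : i ≤ D) : p.θ i ≠ p.θ 0 := by
  refine sub_ne_zero.1 ?_
  rw [p.θ_sub]
  exact div_ne_zero (mul_ne_zero (mul_ne_zero hp.h_ne (hp.one_sub_qpow_ne h1))
    (hp.one_sub_s_ne (by omega) (by omega))) (hp.qpow_ne i)

theorem θs_injective (hp : p.IsQRacah D) (i j : Fin (D + 1)) (h : p.θs i = p.θs j) : i = j := by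
  by_contra hij
  have hij' : (i : ℕ) ≠ j := fun e => hij (Fin.ext e)
  have hi := i.2
  have hj := j.2
  have h0 := sub_eq_zero.2 h
  rw [hp.θs_sub] at h0
  have e1 : 1 / p.q ^ (i : ℕ) - 1 / p.q ^ (j : ℕ) ≠ 0 := by
    have h1 := hp.qpow_ne i
    have h2 := hp.qpow_ne j
    rw [div_sub_div _ _ h1 h2]
    refine div_ne_zero ?_ (mul_ne_zero h1 h2)
    have := hp.qpow_sub_ne (Ne.symm hij')
    simpa using this
  have e2 := hp.one_sub_ss_ne (i := i + j + 1) (by omega) (by omega)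
  rw [pow_succ, pow_add, ← mul_assoc, ← mul_assoc] at e2
  exact mul_ne_zero (mul_ne_zero hp.hs_ne e1) e2 h0

/-- Each `θ*_j - θ*_l` factors through `q^{-j} - q^{-l}` and `1 - s*q^{j+l+1}`. Shifting `j` and `l`
together changes the first only by a power of `q`, so the ratio of the two products telescopes. -/
theorem splitEigvec_up (hp : p.IsQRacah D) (j n : ℕ) (hn : n < D) :
    splitEigvec p.θs (p.φ D) (j + 1) (n + 1) * (1 - p.ss * p.q * p.q ^ j) * p.φ D (n + 1) =
      p.hs * (1 / (p.q * p.q ^ j) - 1) / p.q ^ n * (1 - p.ss * p.q * p.q ^ n * p.q ^ j) *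
        (1 - p.ss * p.q ^ 2 * p.q ^ n * p.q ^ j) * splitEigvec p.θs (p.φ D) j n := by
  induction n with
  | zero =>
    have h1 := hp.φ_ne 1 (by omega) (by omega)
    rw [splitEigvec_succ, splitEigvec_zero, splitEigvec_zero, hp.θs_sub, pow_succ']
    field_simp
  | succ n ih =>
    have h1 := hp.φ_ne (n + 1) (by omega) (by omega)
    have h2 := hp.φ_ne (n + 1 + 1) (by omega) (by omega)
    have ih := ih (by omega)
    rw [splitEigvec_succ p.θs _ (j + 1) (n + 1), splitEigvec_succ p.θs _ j n, hp.θs_sub, hp.θs_sub]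
    have e : splitEigvec p.θs (p.φ D) (j + 1) (n + 1) * (1 - p.ss * p.q * p.q ^ j) =
      p.hs * (1 / (p.q * p.q ^ j) - 1) / p.q ^ n * (1 - p.ss * p.q * p.q ^ n * p.q ^ j) *
        (1 - p.ss * p.q ^ 2 * p.q ^ n * p.q ^ j) * splitEigvec p.θs (p.φ D) j n / p.φ D (n + 1) := by
      rw [← ih]; field_simp
    rw [show ∀ w X f s : ℂ, f ≠ 0 → w * (X / f) * s * f = w * s * X by
      intro w X f s hf; field_simp]
    · rw [e, pow_succ' _ n, pow_succ' _ j]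
      have := hp.q_ne
      have := hp.qpow_ne n
      have := hp.qpow_ne j
      field_simp
    · exact h2

theorem splitEigvec_down (hp : p.IsQRacah D) (j n : ℕ) (hn : n < D) :
    splitEigvec p.θs (p.φ D) j (n + 1) * (1 / p.q ^ (j + 1) - 1) * p.φ D (n + 1) =
      p.hs * (1 / p.q ^ (j + 1) - 1 / p.q ^ n) * (p.q / p.q ^ (j + 1) - 1 / p.q ^ n) * p.q ^ n *
        (1 - p.ss * p.q ^ (j + 1)) * splitEigvec p.θs (p.φ D) (j + 1) n := by
  induction n with
  | zero =>
    have h1 := hp.φ_ne 1 (by omega) (by omega)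
    have := hp.q_ne
    have := hp.qpow_ne j
    rw [splitEigvec_succ, splitEigvec_zero, splitEigvec_zero, hp.θs_sub, pow_succ']
    field_simp
  | succ n ih =>
    have h1 := hp.φ_ne (n + 1) (by omega) (by omega)
    have h2 := hp.φ_ne (n + 1 + 1) (by omega) (by omega)
    have ih := ih (by omega)
    rw [splitEigvec_succ p.θs _ j (n + 1), splitEigvec_succ p.θs _ (j + 1) n, hp.θs_sub, hp.θs_sub]
    have e : splitEigvec p.θs (p.φ D) j (n + 1) * (1 / p.q ^ (j + 1) - 1) =
      p.hs * (1 / p.q ^ (j + 1) - 1 / p.q ^ n) * (p.q / p.q ^ (j + 1) - 1 / p.q ^ n) * p.q ^ n *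
        (1 - p.ss * p.q ^ (j + 1)) * splitEigvec p.θs (p.φ D) (j + 1) n / p.φ D (n + 1) := by
      rw [← ih]; field_simp
    rw [show ∀ w X f s : ℂ, f ≠ 0 → w * (X / f) * s * f = w * s * X by
      intro w X f s hf; field_simp]
    · rw [e, pow_succ' _ n, pow_succ' _ j]
      have := hp.q_ne
      have := hp.qpow_ne n
      have := hp.qpow_ne j
      field_simp
    · exact h2

/-- For `j ≥ 1` every term is a rational multiple of `w_j(n) / φ_{n+1}`, which reduces the claim to
the rational identities. -/
theorem difference_equation (hp : p.IsQRacah D) (hD : 1 ≤ D) (n j : ℕ) (hn : n < D) (hj : j ≤ D) :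
    (p.θ (n + 1) - p.θ 0) * splitEigvec p.θs (p.φ D) j (n + 1) + splitEigvec p.θs (p.φ D) j n =
      p.racahC D j * (splitEigvec p.θs (p.φ D) (j - 1) (n + 1) -
        splitEigvec p.θs (p.φ D) j (n + 1)) +
      p.racahB D j * (splitEigvec p.θs (p.φ D) (j + 1) (n + 1) -
        splitEigvec p.θs (p.φ D) j (n + 1)) := by
  have hq := hp.q_ne
  have hφ := hp.φ_ne (n + 1) (by omega) (by omega)
  have hx := hp.qpow_ne n
  have hQ := hp.qpow_ne D
  have hS := hp.ss_ne
  rcases Nat.eq_zero_or_pos j with rfl | hj0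
  -- For `j = 0` the vector `w_0` is supported at coordinate `0`; only `n = 0` has content, and
  -- there it says `b_0 (θ*_1 - θ*_0) = φ_1`.
  · have hC : p.racahC D 0 = 0 := by
      rw [racahC, if_neg (by omega)]; simp
    rw [hC, zero_mul, splitEigvec_eq_zero p.θs _ (Nat.succ_pos n)]
    rcases Nat.eq_zero_or_pos n with rfl | hn0
    · have h1 := hp.one_sub_ss_ne (i := 2) (by omega) (by omega)
      have hB : p.racahB D 0 * (p.θs 1 - p.θs 0) = p.φ D (0 + 1) := by
        rw [racahB, if_pos rfl, hp.θs_sub, hp.φ_succ]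
        rw [pow_zero, pow_one]
        rw [show 1 - p.ss * p.q * 1 * p.q = 1 - p.ss * p.q ^ 2 by ring]
        rw [show (1 : ℂ) / 1 = 1 by simp]
        generalize 1 - p.ss * p.q ^ 2 = z at *
        field_simp
      simp only [splitEigvec_succ, splitEigvec_zero, zero_add] at hB hφ ⊢
      have e : p.racahB D 0 * (1 * ((p.θs 1 - p.θs 0) / p.φ D 1)) = 1 := by
        rw [one_mul, ← mul_div_assoc, hB, div_self hφ]
      linear_combination -e
    · rw [splitEigvec_eq_zero p.θs _ hn0, splitEigvec_eq_zero p.θs _ (show 0 + 1 < n + 1 by omega)]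
      ring
  obtain ⟨k, rfl⟩ : ∃ k, j = k + 1 := ⟨j - 1, by omega⟩
  have hy := hp.qpow_ne (k + 1)
  have hy1 := hp.one_sub_qpow_ne (i := k + 1) (by omega)
  have hy2 : 1 / p.q ^ (k + 1) - 1 ≠ 0 := by
    rw [div_sub_one hy]
    exact div_ne_zero hy1 hy
  have hs0 := hp.one_sub_ss_ne (i := (k + 1) * 2) (by omega) (by omega)
  rw [pow_mul] at hs0
  have hdown : splitEigvec p.θs (p.φ D) k (n + 1) =
      p.hs * (1 / p.q ^ (k + 1) - 1 / p.q ^ n) * (p.q / p.q ^ (k + 1) - 1 / p.q ^ n) * p.q ^ n *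
        (1 - p.ss * p.q ^ (k + 1)) / (1 / p.q ^ (k + 1) - 1) *
          (splitEigvec p.θs (p.φ D) (k + 1) n / p.φ D (n + 1)) := by
    rw [div_mul_div_comm, eq_div_iff (mul_ne_zero hy2 hφ), ← hp.splitEigvec_down k n hn]
    ring
  have hmid : splitEigvec p.θs (p.φ D) (k + 1) (n + 1) =
      p.hs * (1 / p.q ^ (k + 1) - 1 / p.q ^ n) * (1 - p.ss * p.q ^ (k + 1) * p.q ^ n * p.q) *
        (splitEigvec p.θs (p.φ D) (k + 1) n / p.φ D (n + 1)) := by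
    rw [splitEigvec_succ, hp.θs_sub]; ring
  have hw : splitEigvec p.θs (p.φ D) (k + 1) n =
      p.φ D (n + 1) * (splitEigvec p.θs (p.φ D) (k + 1) n / p.φ D (n + 1)) := by
    field_simp
  have hθ : p.θ (n + 1) - p.θ 0 = p.h * (1 - p.q * p.q ^ n) *
      (1 - p.r1 * p.r2 / (p.ss * p.q ^ D * p.q) * p.q ^ 2 * p.q ^ n) / (p.q * p.q ^ n) := by
    rw [p.θ_sub, hp.s_eq, pow_succ, pow_succ]; ring
  rw [Nat.add_sub_cancel]
  by_cases hkD : k + 1 = D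
  · have hB : p.racahB D (k + 1) = 0 := by
      rw [racahB, if_neg (by omega), hkD, div_self hQ]; simp
    rw [hB, hdown, hmid, hθ, racahC, if_pos hkD, hkD]
    rw [hkD] at hw hs0
    nth_rewrite 2 [hw]
    rw [hp.φ_succ] at *
    have := racah_difference_top p.q (p.q ^ n) (p.q ^ D) p.ss p.r1 p.r2 p.h p.hs hq hx hQ hS
      (hkD ▸ hy1) hs0
    linear_combination this * (splitEigvec p.θs (p.φ D) D n / (p.h * p.hs / (p.q * (p.q ^ n) ^ 2) *
      (1 - p.q * p.q ^ n) * (1 - p.q ^ n / p.q ^ D) * (1 - p.r1 * p.q * p.q ^ n) *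
        (1 - p.r2 * p.q * p.q ^ n)))
  · have hs1 := hp.one_sub_ss_ne (i := 1 + (k + 1) * 2) (by omega) (by omega)
    have hs2 := hp.one_sub_ss_ne (i := 2 + (k + 1) * 2) (by omega) (by omega)
    have hs3 := hp.one_sub_ss_ne (i := 1 + (k + 1)) (by omega) (by omega)
    rw [pow_add, pow_mul, ← mul_assoc] at hs1 hs2
    rw [pow_add, ← mul_assoc] at hs3
    rw [pow_one] at hs1 hs3
    have hup : splitEigvec p.θs (p.φ D) (k + 1 + 1) (n + 1) =
        p.hs * (1 / (p.q * p.q ^ (k + 1)) - 1) / p.q ^ n *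
          (1 - p.ss * p.q * p.q ^ n * p.q ^ (k + 1)) *
          (1 - p.ss * p.q ^ 2 * p.q ^ n * p.q ^ (k + 1)) / (1 - p.ss * p.q * p.q ^ (k + 1)) *
          (splitEigvec p.θs (p.φ D) (k + 1) n / p.φ D (n + 1)) := by
      rw [div_mul_div_comm, eq_div_iff (mul_ne_zero hs3 hφ), ← hp.splitEigvec_up (k + 1) n hn]
      ring
    rw [hup, hdown, hmid, hθ, racahC, if_neg hkD, racahB, if_neg (by omega)]
    nth_rewrite 2 [hw]
    rw [hp.φ_succ] at *
    have := racah_difference_generic p.q (p.q ^ n) (p.q ^ (k + 1)) (p.q ^ D) p.ss p.r1 p.r2 p.h p.hs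
      hq hx hy hQ hS hy1 hs0 hs1 hs2 hs3
    linear_combination this * (splitEigvec p.θs (p.φ D) (k + 1) n / (p.h * p.hs /
      (p.q * (p.q ^ n) ^ 2) *
      (1 - p.q * p.q ^ n) * (1 - p.q ^ n / p.q ^ D) * (1 - p.r1 * p.q * p.q ^ n) *
        (1 - p.r2 * p.q * p.q ^ n)))

theorem racahB_ne (hp : p.IsQRacah D) (i : ℕ) (hi : i < D) : p.racahB D i ≠ 0 := by
  have h1 := hp.one_sub_div_ne (i := i) (by omega)
  have h3 := hp.one_sub_r1_ne (i := 1 + i) (by omega) (by omega)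
  have h4 := hp.one_sub_r2_ne (i := 1 + i) (by omega) (by omega)
  rw [pow_add, pow_one, ← mul_assoc] at h3 h4
  rw [racahB]
  split_ifs with h
  · subst h
    rw [pow_zero, mul_one] at h3 h4
    rw [pow_zero] at h1
    exact div_ne_zero (mul_ne_zero (mul_ne_zero (mul_ne_zero hp.h_ne h1) h3) h4)
      (hp.one_sub_ss_ne le_rfl (by omega))
  · have h2 := hp.one_sub_ss_ne (i := 1 + i) (by omega) (by omega)
    have hs1 := hp.one_sub_ss_ne (i := 1 + i * 2) (by omega) (by omega)
    have hs2 := hp.one_sub_ss_ne (i := 2 + i * 2) (by omega) (by omega)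
    rw [pow_add, pow_mul, ← mul_assoc] at hs1 hs2
    rw [pow_add, ← mul_assoc] at h2
    rw [pow_one] at hs1 h2
    exact div_ne_zero (mul_ne_zero (mul_ne_zero (mul_ne_zero (mul_ne_zero hp.h_ne h1) h2) h3) h4)
      (mul_ne_zero hs1 hs2)

theorem racahC_ne (hp : p.IsQRacah D) (i : ℕ) (h1 : 1 ≤ i) (hi : i ≤ D) : p.racahC D i ≠ 0 := by
  have e1 := hp.one_sub_qpow_ne h1
  have e2 := hp.r1_sub_ne h1 hi
  have e3 := hp.r2_sub_ne h1 hi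
  have hs0 := hp.one_sub_ss_ne (i := i * 2) (by omega) (by omega)
  rw [pow_mul] at hs0
  have hS := mul_ne_zero hp.ss_ne (hp.qpow_ne D)
  rw [racahC]
  split_ifs with h
  · subst h
    exact div_ne_zero (mul_ne_zero (mul_ne_zero (mul_ne_zero hp.h_ne e1) e2) e3)
      (mul_ne_zero hS hs0)
  · have hs1 := hp.one_sub_ss_ne (i := 1 + i * 2) (by omega) (by omega)
    have hs2 := hp.one_sub_ss_ne (i := i + D + 1) (by omega) (by omega)
    rw [pow_add, pow_mul, ← mul_assoc, pow_one] at hs1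
    rw [pow_add, pow_add, pow_one, ← mul_assoc, ← mul_assoc] at hs2
    exact div_ne_zero (mul_ne_zero (mul_ne_zero (mul_ne_zero (mul_ne_zero hp.h_ne e1) hs2) e2) e3)
      (mul_ne_zero (mul_ne_zero hS hs0) hs1)

theorem k_eq_prod (hp : p.IsQRacah D) (hD : 1 ≤ D) (i : ℕ) (hi : i ≤ D) :
    p.k D i = ∏ l ∈ Finset.range i, p.racahB D l / p.racahC D (l + 1) := by
  refine kNum_eq_prod D p.θ p.θs (p.φ D) (p.racahB D) (p.racahC D) hp.θ_ne hp.θs_injective hp.φ_ne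
    ?_ hp.racahB_ne hp.racahC_ne (fun n j hn hj => hp.difference_equation hD n j hn hj) i hi
  rw [racahB, if_neg (by omega), div_self (hp.qpow_ne D)]
  simp

end IsQRacah
end QRacahParams

/-! ### q-shifted factorials and inversion of the base -/

theorem qPoch_zero {R : Type*} [CommRing R] (x q : R) : qPoch x q 0 = 1 := by simp [qPoch]

theorem qPoch_succ {R : Type*} [CommRing R] (x q : R) (n : ℕ) :
    qPoch x q (n + 1) = qPoch x q n * (1 - x * q ^ n) :=
  Finset.prod_range_succ _ _

theorem qPoch_add {R : Type*} [CommRing R] (x q : R) (m n : ℕ) :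
    qPoch x q (m + n) = qPoch x q m * qPoch (x * q ^ m) q n := by
  simp only [qPoch, Finset.prod_range_add, pow_add, mul_assoc]

theorem qPoch_one {R : Type*} [CommRing R] (x q : R) : qPoch x q 1 = 1 - x := by
  simp [qPoch]

theorem qPoch_succ' {R : Type*} [CommRing R] (x q : R) (n : ℕ) :
    qPoch x q (n + 1) = (1 - x) * qPoch (x * q) q n := by
  rw [add_comm, qPoch_add, qPoch_one, pow_one]

theorem qPoch_ne_zero {x q : ℂ} {n : ℕ} (h : ∀ l < n, 1 - x * q ^ l ≠ 0) : qPoch x q n ≠ 0 :=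
  Finset.prod_ne_zero_iff.2 fun l hl => h l (Finset.mem_range.1 hl)

/-- Inversion of the base of a `q`-shifted factorial. -/
theorem qPoch_inv_base {R : Type*} [CommRing R] {x x' q q' : R} (hx : x * x' = 1) (hq : q * q' = 1)
    (n : ℕ) :
    qPoch x' q' n = qPoch x q n * ((-x') ^ n * ∏ l ∈ Finset.range n, q' ^ l) := by
  induction n with
  | zero => simp [qPoch]
  | succ n ih =>
    have h : (1 - x * q ^ n) * (-x' * q' ^ n) = 1 - x' * q' ^ n := by
      have : q ^ n * q' ^ n = 1 := by rw [← mul_pow, hq, one_pow]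
      linear_combination (x * x') * this + hx
    rw [qPoch_succ, qPoch_succ, Finset.prod_range_succ, pow_succ, ih, ← h]
    ring

/-- Used with `a, b, c, d, q` standing for their `j`-th powers, `X = q^{nj}`, `ε = (-1)^j` and `W =
q^{-j(j-1)/2}`; the `A`'s are the `q`-shifted factorials in base `q`. -/
theorem awCoeff_inv_aux (A₁ A₂ A₃ A₄ A₅ A₆ ε X W a b c d q : ℂ) (hε : ε ^ 2 = 1) (hX : X ≠ 0)
    (hW : W ≠ 0) (ha : a ≠ 0) (hb : b ≠ 0) (hc : c ≠ 0) (hd : d ≠ 0) (hq : q ≠ 0) :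
    A₁ * (ε * X * W) * (A₂ * (ε * (a⁻¹ * b⁻¹ * c⁻¹ * d⁻¹ * (q / X)) * W)) /
      (A₃ * (ε * (a⁻¹ * b⁻¹) * W) * (A₄ * (ε * (a⁻¹ * c⁻¹) * W)) *
        (A₅ * (ε * (a⁻¹ * d⁻¹) * W)) * (A₆ * (ε * q⁻¹ * W))) * q⁻¹ * ((a ^ 2)⁻¹ * W ^ 2) =
      A₁ * A₂ / (A₃ * A₄ * A₅ * A₆) * q := by
  have h1 : A₁ * (ε * X * W) * (A₂ * (ε * (a⁻¹ * b⁻¹ * c⁻¹ * d⁻¹ * (q / X)) * W)) =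
      A₁ * A₂ * (W ^ 2 * (a⁻¹ * b⁻¹ * c⁻¹ * d⁻¹ * q)) := by
    have : X * (q / X) = q := by field_simp
    linear_combination A₁ * A₂ * W ^ 2 * (a⁻¹ * b⁻¹ * c⁻¹ * d⁻¹) * ((X * (q / X)) * hε + this)
  have h2 : A₃ * (ε * (a⁻¹ * b⁻¹) * W) * (A₄ * (ε * (a⁻¹ * c⁻¹) * W)) *
      (A₅ * (ε * (a⁻¹ * d⁻¹) * W)) * (A₆ * (ε * q⁻¹ * W)) = A₃ * A₄ * A₅ * A₆ *
        (W ^ 4 * (a⁻¹ ^ 3 * b⁻¹ * c⁻¹ * d⁻¹ * q⁻¹)) := by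
    linear_combination A₃ * A₄ * A₅ * A₆ *
        (W ^ 4 * (a⁻¹ ^ 3 * b⁻¹ * c⁻¹ * d⁻¹ * q⁻¹)) * (ε ^ 2 + 1) * hε
  rw [h1, h2, mul_div_mul_comm]
  have h3 : W ^ 2 * (a⁻¹ * b⁻¹ * c⁻¹ * d⁻¹ * q) / (W ^ 4 * (a⁻¹ ^ 3 * b⁻¹ * c⁻¹ * d⁻¹ * q⁻¹)) *
      q⁻¹ * ((a ^ 2)⁻¹ * W ^ 2) = q := by
    field_simp
  linear_combination (A₁ * A₂ / (A₃ * A₄ * A₅ * A₆)) * h3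

open LaurentPolynomial in
-- The invariance holds term by term. With four factors above and four below, signs and powers
-- `q^{-j(j-1)/2}` cancel. By balancedness the arguments contribute `q^{2j}`, which turns `q^{-j}`
-- into `q^j`.
theorem awPoly_inv (a b c d q : ℂ) (ha : a ≠ 0) (hb : b ≠ 0) (hc : c ≠ 0) (hd : d ≠ 0) (hq : q ≠ 0)
    (n : ℕ) : awPoly a⁻¹ b⁻¹ c⁻¹ d⁻¹ q⁻¹ n = awPoly a b c d q n := by
  refine Finset.sum_congr rfl fun j _ => ?_
  have hqq : q * q⁻¹ = 1 := mul_inv_cancel₀ hq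
  have hCq : (C q : LaurentPolynomial ℂ) * C q⁻¹ = 1 := by rw [← map_mul, hqq, map_one]
  have hCa : (C a : LaurentPolynomial ℂ) * C a⁻¹ = 1 := by
    rw [← map_mul, mul_inv_cancel₀ ha, map_one]
  have hT : (T 1 : LaurentPolynomial ℂ) * T (-1) = 1 := by rw [← T_add]; simp
  set W : ℂ := ∏ l ∈ Finset.range j, q⁻¹ ^ l with hW
  have hW0 : W ≠ 0 := Finset.prod_ne_zero_iff.2 fun l _ => pow_ne_zero _ (inv_ne_zero hq)
  have hCW : ∏ l ∈ Finset.range j, (C q⁻¹ : LaurentPolynomial ℂ) ^ l = C W := by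
    rw [hW, map_prod]; simp only [map_pow]
  have e1 := qPoch_inv_base (x := (C a * T (-1) : LaurentPolynomial ℂ)) (x' := C a⁻¹ * T 1)
    (by linear_combination (T 1 * T (-1)) * hCa + hT) hCq j
  have e2 := qPoch_inv_base (x := (C a * T 1 : LaurentPolynomial ℂ)) (x' := C a⁻¹ * T (-1))
    (by linear_combination (T 1 * T (-1)) * hCa + hT) hCq j
  have e3 : (-(C a⁻¹ * T 1)) ^ j * C W * ((-(C a⁻¹ * T (-1))) ^ j * C W) =
      (C (a⁻¹ ^ (2 * j) * W ^ 2) : LaurentPolynomial ℂ) := by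
    rw [map_mul, map_pow, map_pow, pow_mul]
    calc _ = (-(C a⁻¹ * T 1) * -(C a⁻¹ * T (-1)) : LaurentPolynomial ℂ) ^ j * C W ^ 2 := by
          rw [mul_pow]; ring
      _ = _ := by
        congr 2
        linear_combination (C a⁻¹ ^ 2) * hT
  have e4 : qPoch (C a⁻¹ * T 1 : LaurentPolynomial ℂ) (C q⁻¹) j *
      qPoch (C a⁻¹ * T (-1) : LaurentPolynomial ℂ) (C q⁻¹) j =
      (a⁻¹ ^ (2 * j) * W ^ 2) •
        (qPoch (C a * T 1) (C q) j * qPoch (C a * T (-1)) (C q) j) := by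
    rw [e1, e2, hCW, smul_eq_C_mul, ← e3]
    ring
  rw [e4, smul_smul]
  congr 1
  have inv : ∀ x x' : ℂ, x * x' = 1 → qPoch x' q⁻¹ j =
      qPoch x q j * ((-1) ^ j * x' ^ j * W) := fun x x' h => by
    rw [qPoch_inv_base h hqq j, ← mul_pow, neg_one_mul]
  have hqn : q ^ n ≠ 0 := pow_ne_zero _ hq
  have hz : q ^ ((n : ℤ) - 1) = q ^ n / q := by rw [zpow_sub₀ hq, zpow_natCast, zpow_one]
  have hz' : q⁻¹ ^ ((n : ℤ) - 1) = q / q ^ n := by rw [inv_zpow, hz, inv_div]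
  rw [inv ((q ^ n)⁻¹) ((q⁻¹ ^ n)⁻¹) (by simp [hqn]),
    inv (a * b * c * d * q ^ ((n : ℤ) - 1)) (a⁻¹ * b⁻¹ * c⁻¹ * d⁻¹ * q⁻¹ ^ ((n : ℤ) - 1))
      (by rw [hz, hz']; field_simp),
    inv (a * b) (a⁻¹ * b⁻¹) (by field_simp), inv (a * c) (a⁻¹ * c⁻¹) (by field_simp),
    inv (a * d) (a⁻¹ * d⁻¹) (by field_simp), inv q q⁻¹ hqq, hz']
  generalize qPoch ((q ^ n)⁻¹) q j = A1
  generalize qPoch (a * b * c * d * q ^ ((n : ℤ) - 1)) q j = A2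
  generalize qPoch (a * b) q j = A3
  generalize qPoch (a * c) q j = A4
  generalize qPoch (a * d) q j = A5
  generalize qPoch q q j = A6
  have hone : ((-1 : ℂ) ^ j) ^ 2 = 1 := by rw [← pow_mul, mul_comm, pow_mul]; simp
  have haj : a⁻¹ ^ (2 * j) = ((a ^ j) ^ 2)⁻¹ := by rw [inv_pow, ← pow_mul, mul_comm j 2]
  rw [haj]
  simp only [mul_pow, div_pow, inv_pow, inv_inv]
  exact awCoeff_inv_aux _ _ _ _ _ _ _ _ _ _ _ _ _ _ hone (pow_ne_zero _ hqn) hW0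
    (pow_ne_zero _ ha) (pow_ne_zero _ hb) (pow_ne_zero _ hc) (pow_ne_zero _ hd) (pow_ne_zero _ hq)

/-! ### Invariance of the parameter array and the reduced array -/

namespace QRacahParams

theorem qInv_q (p : QRacahParams) : p.qInv.q = p.q⁻¹ := by simp [q, qInv]
theorem qInv_s (p : QRacahParams) : p.qInv.s = p.s⁻¹ := by simp [s, qInv]
theorem qInv_ss (p : QRacahParams) : p.qInv.ss = p.ss⁻¹ := by simp [ss, qInv]
theorem qInv_r1 (p : QRacahParams) : p.qInv.r1 = p.r1⁻¹ := by simp [r1, qInv]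
theorem qInv_r2 (p : QRacahParams) : p.qInv.r2 = p.r2⁻¹ := by simp [r2, qInv]
theorem qInv_a (p : QRacahParams) (D : ℕ) : p.qInv.a D = (p.a D)⁻¹ := by
  simp [a, qInv, div_eq_mul_inv]; ring
theorem qInv_b (p : QRacahParams) (D : ℕ) : p.qInv.b D = (p.b D)⁻¹ := by
  simp [b, qInv, div_eq_mul_inv]; ring
theorem qInv_c (p : QRacahParams) (D : ℕ) : p.qInv.c D = (p.c D)⁻¹ := by
  simp [c, qInv, div_eq_mul_inv]; ring
theorem qInv_d (p : QRacahParams) (D : ℕ) : p.qInv.d D = (p.d D)⁻¹ := by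
  simp [d, qInv, div_eq_mul_inv]; ring

namespace IsQRacah

variable {p : QRacahParams} {D : ℕ}

theorem qInv_θ (hp : p.IsQRacah D) (i : ℕ) : p.qInv.θ i = p.θ i := by
  have h1 := hp.q_ne
  have h2 := hp.s_ne
  have h3 := hp.qpow_ne i
  simp only [θ, qInv_q, qInv_s, inv_pow, pow_succ]
  simp only [qInv]
  field_simp
  ring

theorem qInv_θs (hp : p.IsQRacah D) (i : ℕ) : p.qInv.θs i = p.θs i := by
  have h1 := hp.q_ne
  have h2 := hp.ss_ne
  have h3 := hp.qpow_ne i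
  simp only [θs, qInv_q, qInv_ss, inv_pow, pow_succ]
  simp only [qInv]
  field_simp
  ring

/-- The `s s*` brought in by `h'` and `h*'` compensates the `1/(r₁r₂)` from the inverted factors, by
`r₁r₂ = s s* q^{D+1}`. -/
theorem qInv_φ (hp : p.IsQRacah D) (i : ℕ) : p.qInv.φ D i = p.φ D i := by
  have h1 := hp.q_ne
  have h2 := hp.ss_ne
  have h3 := hp.qpow_ne i
  have h4 := hp.r1_ne
  have h5 := hp.r2_ne
  have h6 := hp.qpow_ne D
  have e1 : p.q ^ (1 - 2 * (i : ℤ)) = p.q / (p.q ^ i) ^ 2 := by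
    rw [zpow_sub₀ h1, zpow_one, mul_comm, zpow_mul, zpow_natCast]; rfl
  have e2 : p.q ^ ((i : ℤ) - (D : ℤ) - 1) = p.q ^ i / (p.q ^ D * p.q) := by
    rw [zpow_sub₀ h1, zpow_sub₀ h1, zpow_one, zpow_natCast, zpow_natCast, div_div]
  simp only [φ, qInv_q, qInv_r1, qInv_r2, inv_pow, inv_zpow, e1, e2]
  simp only [qInv]
  rw [hp.s_eq]
  field_simp
  ring

theorem qInv_k (hp : p.IsQRacah D) (i : ℕ) : p.qInv.k D i = p.k D i := by
  rw [k, k, funext hp.qInv_θ, funext hp.qInv_θs, funext hp.qInv_φ]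

theorem qInv_perp (hp : p.IsQRacah D) : p.qInv.perp = p.perp.qInv := by
  have h1 := hp.q_ne
  have e1 := hp.qInv_θ 1
  have e2 := hp.qInv_θs 1
  have e3 : p.perp.q = p.q := rfl
  have e4 : p.perp.s = p.s * p.q ^ 2 := by simp [s, perp]; ring
  have e5 : p.perp.ss = p.ss * p.q ^ 2 := by simp [ss, perp]; ring
  rw [perp, e1, e2, qInv_q]
  conv_rhs => rw [qInv, e3, e4, e5]
  simp only [qInv, perp, QRacahParams.mk.injEq, mul_inv, inv_inv, true_and, and_true]
  constructor <;> field_simp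

theorem perp_isQRacah (hp : p.IsQRacah D) (hD : 2 ≤ D) : p.perp.IsQRacah (D - 2) := by
  have hq := hp.q_ne
  have hr1 := hp.r1_ne
  have hr2 := hp.r2_ne
  have e3 : p.perp.q = p.q := rfl
  have e4 : p.perp.s = p.s * p.q ^ 2 := by simp [s, perp]; ring
  have e5 : p.perp.ss = p.ss * p.q ^ 2 := by simp [ss, perp]; ring
  have e6 : p.perp.r1 = p.r1 * p.q := by simp [r1, perp, q]; ring
  have e7 : p.perp.r2 = p.r2 * p.q := by simp [r2, perp, q]; ring
  refine ⟨hp.qh_ne, hp.q_not_root, mul_ne_zero hp.sh_ne hq, mul_ne_zero hp.ssh_ne hq,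
    mul_ne_zero hp.r1h_ne hp.qh_ne, mul_ne_zero hp.r2h_ne hp.qh_ne,
    mul_ne_zero hp.h_ne (inv_ne_zero hq), mul_ne_zero hp.hs_ne (inv_ne_zero hq), ?_, ?_, ?_, ?_, ?_,
    ?_, ?_⟩
  · obtain ⟨k, rfl⟩ : ∃ k, D = k + 2 := ⟨D - 2, by omega⟩
    have := hp.r_mul
    simp only [perp, q, Nat.add_sub_cancel]
    linear_combination p.qh ^ 2 * this
  · intro i h1 h2
    rw [e6, e3, mul_assoc, ← pow_succ']
    exact hp.r1_nd _ (by omega) (by omega)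
  · intro i h1 h2
    rw [e7, e3, mul_assoc, ← pow_succ']
    exact hp.r2_nd _ (by omega) (by omega)
  · intro i h1 h2
    rw [e6, e3, e5]
    have := hp.ssr1_nd (i + 1) (by omega) (by omega)
    rwa [show p.ss * p.q ^ 2 * p.q ^ i / (p.r1 * p.q) = p.ss * p.q ^ (i + 1) / p.r1 by
      field_simp; ring]
  · intro i h1 h2
    rw [e7, e3, e5]
    have := hp.ssr2_nd (i + 1) (by omega) (by omega)
    rwa [show p.ss * p.q ^ 2 * p.q ^ i / (p.r2 * p.q) = p.ss * p.q ^ (i + 1) / p.r2 by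
      field_simp; ring]
  · intro i h1 h2
    rw [e4, e3, mul_assoc, ← pow_add]
    exact hp.s_nd _ (by omega) (by omega)
  · intro i h1 h2
    rw [e5, e3, mul_assoc, ← pow_add]
    exact hp.ss_nd _ (by omega) (by omega)

/-- With its companions for `b, c, d`: the reduced array has Askey-Wilson parameters `aq, bq, c, d`,
so closed forms for `k` apply to `k^⊥` as well. -/
theorem perp_a (hp : p.IsQRacah D) (hD : 2 ≤ D) : p.perp.a (D - 2) = p.a D * p.q := by
  obtain ⟨k, rfl⟩ : ∃ k, D = k + 2 := ⟨D - 2, by omega⟩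
  have := hp.qh_ne
  have := hp.ssh_ne
  simp only [a, perp, q, Nat.add_sub_cancel]
  field_simp
  ring

theorem perp_b (hp : p.IsQRacah D) (hD : 2 ≤ D) : p.perp.b (D - 2) = p.b D * p.q := by
  obtain ⟨k, rfl⟩ : ∃ k, D = k + 2 := ⟨D - 2, by omega⟩
  have := hp.qh_ne
  have := hp.r1h_ne
  have := hp.r2h_ne
  simp only [b, perp, q, Nat.add_sub_cancel]
  field_simp
  ring

theorem perp_c (hp : p.IsQRacah D) (hD : 2 ≤ D) : p.perp.c (D - 2) = p.c D := by
  obtain ⟨k, rfl⟩ : ∃ k, D = k + 2 := ⟨D - 2, by omega⟩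
  have := hp.qh_ne
  have := hp.r1h_ne
  simp only [c, perp, q, Nat.add_sub_cancel]
  field_simp
  ring

theorem perp_d (hp : p.IsQRacah D) (hD : 2 ≤ D) : p.perp.d (D - 2) = p.d D := by
  obtain ⟨k, rfl⟩ : ∃ k, D = k + 2 := ⟨D - 2, by omega⟩
  have := hp.qh_ne
  have := hp.r2h_ne
  simp only [d, perp, q, Nat.add_sub_cancel]
  field_simp
  ring

/-! ### Askey-Wilson parameters and the closed form of k -/

theorem a_ne (hp : p.IsQRacah D) : p.a D ≠ 0 :=
  div_ne_zero (mul_ne_zero hp.r1h_ne hp.r2h_ne) (mul_ne_zero hp.ssh_ne (pow_ne_zero _ hp.qh_ne))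
theorem b_ne (hp : p.IsQRacah D) : p.b D ≠ 0 :=
  div_ne_zero hp.ssh_ne (mul_ne_zero (mul_ne_zero hp.r1h_ne hp.r2h_ne) (pow_ne_zero _ hp.qh_ne))
theorem c_ne (hp : p.IsQRacah D) : p.c D ≠ 0 :=
  div_ne_zero (mul_ne_zero (mul_ne_zero hp.r2h_ne hp.ssh_ne) (pow_ne_zero _ hp.qh_ne)) hp.r1h_ne
theorem d_ne (hp : p.IsQRacah D) : p.d D ≠ 0 :=
  div_ne_zero (mul_ne_zero (mul_ne_zero hp.r1h_ne hp.ssh_ne) (pow_ne_zero _ hp.qh_ne)) hp.r2h_ne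

theorem ab_eq (hp : p.IsQRacah D) : p.a D * p.b D = 1 / p.q ^ D := by
  have := hp.qh_ne
  have := hp.r1h_ne
  have := hp.r2h_ne
  have := hp.ssh_ne
  simp only [a, b, q]
  field_simp
  ring

theorem ac_eq (hp : p.IsQRacah D) : p.a D * p.c D = p.r2 * p.q := by
  have := hp.qh_ne
  have := hp.r1h_ne
  have := hp.ssh_ne
  simp only [a, c, q, r2]
  field_simp
  ring

theorem ad_eq (hp : p.IsQRacah D) : p.a D * p.d D = p.r1 * p.q := by
  have := hp.qh_ne
  have := hp.r2h_ne
  have := hp.ssh_ne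
  simp only [a, d, q, r1]
  field_simp
  ring

theorem bc_eq (hp : p.IsQRacah D) : p.b D * p.c D = p.ss * p.q / p.r1 := by
  have := hp.qh_ne
  have := hp.r1h_ne
  have := hp.r2h_ne
  simp only [b, c, q, r1, ss]
  field_simp
  ring

theorem bd_eq (hp : p.IsQRacah D) : p.b D * p.d D = p.ss * p.q / p.r2 := by
  have := hp.qh_ne
  have := hp.r1h_ne
  have := hp.r2h_ne
  simp only [b, d, q, r2, ss]
  field_simp
  ring

theorem cd_eq (hp : p.IsQRacah D) : p.c D * p.d D = p.ss * p.q ^ D * p.q ^ 2 := by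
  have := hp.r1h_ne
  have := hp.r2h_ne
  simp only [c, d, q, ss]
  field_simp
  ring

theorem abcd_eq (hp : p.IsQRacah D) : p.a D * p.b D * p.c D * p.d D = p.ss * p.q ^ 2 := by
  have := hp.qpow_ne D
  rw [mul_assoc, hp.ab_eq, hp.cd_eq]
  field_simp

end IsQRacah
end QRacahParams

theorem div_eq_div_of_common_factor {N M N' M' u : ℂ} (hu : u ≠ 0) (hN : N = N' * u)
    (hM : M = M' * u) : N / M = N' / M' := by
  rw [hN, hM, mul_div_mul_right _ _ hu]

namespace QRacahParams
namespace IsQRacah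

variable {p : QRacahParams} {D : ℕ}

theorem one_sub_ab_ne (hp : p.IsQRacah D) {l : ℕ} (h : l ≠ D) :
    1 - p.a D * p.b D * p.q ^ l ≠ 0 := by
  rw [hp.ab_eq, one_div_mul_eq_div]
  exact hp.one_sub_div_ne h

theorem one_sub_abcd_ne (hp : p.IsQRacah D) {l : ℕ} (h : l + 2 ≤ 2 * D) :
    1 - p.a D * p.b D * p.c D * p.d D * p.q ^ l ≠ 0 := by
  rw [hp.abcd_eq, mul_assoc, ← pow_add]
  exact hp.one_sub_ss_ne (by omega) (by omega)

/-- Here `cd q^l = s*q^{D+l+2}`. At `l = D - 1` the exponent is `2D + 1`, beyond the standing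
assumptions; hence only `(cd;q)_{D-1}` appears in the top case. -/
theorem one_sub_cd_ne (hp : p.IsQRacah D) {l : ℕ} (h : l + 2 ≤ D) :
    1 - p.c D * p.d D * p.q ^ l ≠ 0 := by
  rw [hp.cd_eq, mul_assoc, mul_assoc, ← pow_add, ← pow_add]
  exact hp.one_sub_ss_ne (by omega) (by omega)

theorem one_sub_bc_ne (hp : p.IsQRacah D) {l : ℕ} (h : l + 1 ≤ D) :
    1 - p.b D * p.c D * p.q ^ l ≠ 0 := by
  have h1 := hp.r1_sub_ne (i := l + 1) (by omega) h
  have h2 := hp.r1_ne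
  rw [hp.bc_eq]
  intro h3
  apply h1
  field_simp at h3
  rw [pow_succ']
  linear_combination h3

theorem one_sub_bd_ne (hp : p.IsQRacah D) {l : ℕ} (h : l + 1 ≤ D) :
    1 - p.b D * p.d D * p.q ^ l ≠ 0 := by
  have h1 := hp.r2_sub_ne (i := l + 1) (by omega) h
  have h2 := hp.r2_ne
  rw [hp.bd_eq]
  intro h3
  apply h1
  field_simp at h3
  rw [pow_succ']
  linear_combination h3

theorem racahB_zero_eq (hp : p.IsQRacah D) :
    p.racahB D 0 = p.h * ((1 - p.a D * p.b D) * (1 - p.a D * p.c D) * (1 - p.a D * p.d D)) /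
      (1 - p.a D * p.b D * p.c D * p.d D) := by
  rw [racahB, if_pos rfl, hp.ab_eq, hp.ac_eq, hp.ad_eq]
  rw [← hp.ab_eq, hp.abcd_eq, hp.ab_eq]
  ring

theorem racahB_succ_eq (hp : p.IsQRacah D) (n : ℕ) :
    p.racahB D (n + 1) = p.h * ((1 - p.a D * p.b D * p.q ^ (n + 1)) *
      (1 - p.a D * p.c D * p.q ^ (n + 1)) * (1 - p.a D * p.d D * p.q ^ (n + 1)) *
      (1 - p.a D * p.b D * p.c D * p.d D * p.q ^ n)) /
      ((1 - p.a D * p.b D * p.c D * p.d D * p.q ^ (2 * n + 1)) *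
        (1 - p.a D * p.b D * p.c D * p.d D * p.q ^ (2 * n + 2))) := by
  rw [racahB, if_neg (by omega), hp.abcd_eq, hp.ab_eq, hp.ac_eq, hp.ad_eq]
  congr 1 <;> ring

theorem _root_.QRacahParams.r1_mul_r2_eq (p : QRacahParams) (D : ℕ) :
    p.r1 * p.r2 / (p.ss * p.q ^ D) = p.a D ^ 2 := by
  simp only [a, r1, r2, ss, q]
  rw [div_pow, mul_pow, mul_pow, ← pow_mul, ← pow_mul, mul_comm 2 D]

theorem racahC_succ_eq (hp : p.IsQRacah D) (n : ℕ)
    (h : n + 1 = D → 1 - p.a D * p.b D * p.c D * p.d D * p.q ^ (2 * n + 1) ≠ 0) :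
    p.racahC D (n + 1) = p.h * (p.a D ^ 2 * ((1 - p.q ^ (n + 1)) *
      (1 - p.b D * p.c D * p.q ^ n) * (1 - p.b D * p.d D * p.q ^ n) *
      (1 - p.c D * p.d D * p.q ^ n))) /
      ((1 - p.a D * p.b D * p.c D * p.d D * p.q ^ (2 * n)) *
        (1 - p.a D * p.b D * p.c D * p.d D * p.q ^ (2 * n + 1))) := by
  have hr1 := hp.r1_ne
  have hr2 := hp.r2_ne
  rw [← p.r1_mul_r2_eq D, hp.bc_eq, hp.bd_eq, hp.cd_eq]
  rw [hp.abcd_eq] at h ⊢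
  have e1 : p.r1 - p.ss * p.q ^ (n + 1) = p.r1 * (1 - p.ss * p.q / p.r1 * p.q ^ n) := by
    field_simp; ring
  have e2 : p.r2 - p.ss * p.q ^ (n + 1) = p.r2 * (1 - p.ss * p.q / p.r2 * p.q ^ n) := by
    field_simp; ring
  rw [racahC]
  split_ifs with hn
  · have h := h hn
    rw [← hn, e1, e2]
    have e3 : p.ss * p.q ^ (n + 1) * p.q ^ 2 * p.q ^ n = p.ss * p.q ^ 2 * p.q ^ (2 * n + 1) := by
      ring
    have e4 : p.ss * (p.q ^ (n + 1)) ^ 2 = p.ss * p.q ^ 2 * p.q ^ (2 * n) := by ring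
    rw [e3, e4]
    generalize 1 - p.ss * p.q ^ 2 * p.q ^ (2 * n + 1) = z at h ⊢
    generalize 1 - p.ss * p.q ^ 2 * p.q ^ (2 * n) = w
    rw [← mul_assoc _ _ z, ← mul_assoc _ _ z, mul_div_mul_right _ _ h]
    ring
  · rw [e1, e2]
    have e3 : p.ss * p.q ^ D * p.q ^ 2 * p.q ^ n = p.ss * p.q ^ (n + 1) * p.q ^ D * p.q := by
      ring
    have e4 : p.ss * (p.q ^ (n + 1)) ^ 2 = p.ss * p.q ^ 2 * p.q ^ (2 * n) := by ring
    have e5 : p.ss * p.q * (p.q ^ (n + 1)) ^ 2 = p.ss * p.q ^ 2 * p.q ^ (2 * n + 1) := by ring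
    rw [e3, e4, e5]
    generalize 1 - p.ss * p.q ^ 2 * p.q ^ (2 * n + 1) = z
    generalize 1 - p.ss * p.q ^ 2 * p.q ^ (2 * n) = w
    ring

theorem racahC_top_eq (hp : p.IsQRacah D) (n : ℕ) (hn : n + 1 = D) :
    p.racahC D (n + 1) = p.h * (p.a D ^ 2 * ((1 - p.q ^ (n + 1)) *
      (1 - p.b D * p.c D * p.q ^ n) * (1 - p.b D * p.d D * p.q ^ n))) /
      (1 - p.a D * p.b D * p.c D * p.d D * p.q ^ (2 * n)) := by
  have hr1 := hp.r1_ne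
  have hr2 := hp.r2_ne
  rw [← p.r1_mul_r2_eq D, hp.bc_eq, hp.bd_eq, hp.abcd_eq]
  have e1 : p.r1 - p.ss * p.q ^ (n + 1) = p.r1 * (1 - p.ss * p.q / p.r1 * p.q ^ n) := by
    field_simp; ring
  have e2 : p.r2 - p.ss * p.q ^ (n + 1) = p.r2 * (1 - p.ss * p.q / p.r2 * p.q ^ n) := by
    field_simp; ring
  rw [racahC, if_pos hn, ← hn, e1, e2]
  have e4 : p.ss * (p.q ^ (n + 1)) ^ 2 = p.ss * p.q ^ 2 * p.q ^ (2 * n) := by ring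
  rw [e4]
  generalize 1 - p.ss * p.q ^ 2 * p.q ^ (2 * n) = w
  ring

theorem k_zero (hp : p.IsQRacah D) (hD : 1 ≤ D) : p.k D 0 = 1 := by
  rw [hp.k_eq_prod hD 0 (by omega), Finset.prod_range_zero]

theorem k_succ (hp : p.IsQRacah D) (n : ℕ) (hn : n + 1 ≤ D) :
    p.k D (n + 1) = p.k D n * (p.racahB D n / p.racahC D (n + 1)) := by
  rw [hp.k_eq_prod (by omega) (n + 1) hn, hp.k_eq_prod (by omega) n (by omega),
    Finset.prod_range_succ]

theorem k_succ_eq_qPoch (hp : p.IsQRacah D) (n : ℕ) (hn : n + 1 ≤ D)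
    (h : 1 - p.a D * p.b D * p.c D * p.d D * p.q ^ (2 * n + 1) ≠ 0) :
    p.k D (n + 1) = qPoch (p.a D * p.b D) p.q (n + 1) * qPoch (p.a D * p.c D) p.q (n + 1) *
        qPoch (p.a D * p.d D) p.q (n + 1) * qPoch (p.a D * p.b D * p.c D * p.d D) p.q n *
        (1 - p.a D * p.b D * p.c D * p.d D * p.q ^ (2 * n + 1)) /
      ((p.a D ^ 2) ^ (n + 1) * (qPoch p.q p.q (n + 1) * qPoch (p.b D * p.c D) p.q (n + 1) *
        qPoch (p.b D * p.d D) p.q (n + 1) * qPoch (p.c D * p.d D) p.q (n + 1))) := by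
  have hh := hp.h_ne
  -- The denominators of `b_n` and `c_{n+1}` share `v = 1 - abcd q^{2n}`. The surviving `w / u`
  -- telescopes in the product.
  have aux : ∀ N u v w M : ℂ, v ≠ 0 → p.h * N / (u * v) / (p.h * M / (v * w)) = N * w / (M * u) := by
    intro N u v w M hv
    rw [div_div_div_eq, show u * v * (p.h * M) = (p.h * v) * (M * u) by ring,
      show p.h * N * (v * w) = (p.h * v) * (N * w) by ring, mul_div_mul_left _ _ (mul_ne_zero hh hv)]
  induction n with
  | zero =>
    have h0 := hp.one_sub_abcd_ne (l := 0) (by omega)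
    rw [pow_zero, mul_one] at h0
    rw [hp.k_succ 0 hn, hp.k_zero (by omega), hp.racahB_zero_eq, hp.racahC_succ_eq 0 (fun _ => h)]
    have := aux ((1 - p.a D * p.b D) * (1 - p.a D * p.c D) * (1 - p.a D * p.d D)) 1
      (1 - p.a D * p.b D * p.c D * p.d D) (1 - p.a D * p.b D * p.c D * p.d D * p.q ^ (2 * 0 + 1))
      (p.a D ^ 2 * ((1 - p.q ^ (0 + 1)) * (1 - p.b D * p.c D * p.q ^ 0) *
        (1 - p.b D * p.d D * p.q ^ 0) * (1 - p.c D * p.d D * p.q ^ 0))) h0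
    simp only [mul_zero, pow_zero, mul_one, zero_add, one_mul, qPoch_one, qPoch_zero, pow_one] at *
    exact this
  | succ n ih =>
    have hu := hp.one_sub_abcd_ne (l := 2 * n + 1) (by omega)
    have hv := hp.one_sub_abcd_ne (l := 2 * n + 2) (by omega)
    rw [hp.k_succ (n + 1) hn, ih (by omega) hu, hp.racahB_succ_eq,
      hp.racahC_succ_eq (n + 1) (fun _ => h), show 2 * (n + 1) = 2 * n + 2 by ring, aux _ _ _ _ _ hv,
      qPoch_succ _ _ (n + 1), qPoch_succ _ _ (n + 1), qPoch_succ _ _ (n + 1), qPoch_succ _ _ (n + 1),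
      qPoch_succ _ _ (n + 1), qPoch_succ _ _ (n + 1), qPoch_succ _ _ (n + 1),
      qPoch_succ (p.a D * p.b D * p.c D * p.d D) _ n, div_mul_div_comm,
      pow_succ (p.a D ^ 2) (n + 1), pow_succ' p.q (n + 1)]
    exact div_eq_div_of_common_factor hu (by ring) (by ring)

/-- The general formula with `1 - abcd q^{2D-1} = 1 - cd q^{D-1}` cancelled, so that it need not be
nonzero. -/
theorem k_top_eq_qPoch (hp : p.IsQRacah D) (n : ℕ) (hn : n + 2 = D) :
    p.k D (n + 2) = qPoch (p.a D * p.b D) p.q (n + 2) * qPoch (p.a D * p.c D) p.q (n + 2) *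
        qPoch (p.a D * p.d D) p.q (n + 2) * qPoch (p.a D * p.b D * p.c D * p.d D) p.q (n + 1) /
      ((p.a D ^ 2) ^ (n + 2) * (qPoch p.q p.q (n + 2) * qPoch (p.b D * p.c D) p.q (n + 2) *
        qPoch (p.b D * p.d D) p.q (n + 2) * qPoch (p.c D * p.d D) p.q (n + 1))) := by
  have hh := hp.h_ne
  have hu := hp.one_sub_abcd_ne (l := 2 * n + 1) (by omega)
  have hv := hp.one_sub_abcd_ne (l := 2 * n + 2) (by omega)
  have aux : ∀ N u v M : ℂ, v ≠ 0 → p.h * N / (u * v) / (p.h * M / v) = N / (M * u) := by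
    intro N u v M hv
    rw [div_div_div_eq, show u * v * (p.h * M) = (p.h * v) * (M * u) by ring,
      show p.h * N * v = (p.h * v) * N by ring, mul_div_mul_left _ _ (mul_ne_zero hh hv)]
  rw [hp.k_succ (n + 1) (by omega), hp.k_succ_eq_qPoch n (by omega) hu, hp.racahB_succ_eq,
    hp.racahC_top_eq (n + 1) hn, show 2 * (n + 1) = 2 * n + 2 by ring, aux _ _ _ _ hv,
    qPoch_succ _ _ (n + 1), qPoch_succ _ _ (n + 1), qPoch_succ _ _ (n + 1), qPoch_succ _ _ (n + 1),
    qPoch_succ _ _ (n + 1), qPoch_succ _ _ (n + 1),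
    qPoch_succ (p.a D * p.b D * p.c D * p.d D) _ n, div_mul_div_comm,
    pow_succ (p.a D ^ 2) (n + 1), pow_succ' p.q (n + 1)]
  exact div_eq_div_of_common_factor hu (by ring) (by ring)

/-- The leading scalar of `awMonic`, for positive degree. -/
theorem _root_.awMonic_succ (a b c d q : ℂ) (n : ℕ) :
    awMonic a b c d q (n + 1) = (qPoch (a * b) q (n + 1) * qPoch (a * c) q (n + 1) *
      qPoch (a * d) q (n + 1) / (a ^ (n + 1) * qPoch (a * b * c * d * q ^ n) q (n + 1))) •
        awPoly a b c d q (n + 1) := by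
  rw [awMonic]
  simp

theorem qPoch_abcd_ne (hp : p.IsQRacah D) {m n : ℕ} (h : m + n + 1 ≤ 2 * D) :
    qPoch (p.a D * p.b D * p.c D * p.d D * p.q ^ m) p.q n ≠ 0 := by
  refine qPoch_ne_zero fun l hl => ?_
  rw [mul_assoc _ (p.q ^ m), ← pow_add]
  exact hp.one_sub_abcd_ne (by omega)

/-- The two factorials of `abcd`, one from `k` and one from the normalization of `P`, join to
`(abcd;q)_{2n+1}`. The factor `1 - abcd q^{2n+1}` is kept apart because the coefficients in `ϵ`
cancel it. -/
theorem k_smul_poly (hp : p.IsQRacah D) (n : ℕ) (hn : n + 1 ≤ D)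
    (h0 : 1 - p.a D * p.b D * p.c D * p.d D * p.q ^ (2 * n + 1) ≠ 0) :
    p.k D (n + 1) • awPoly (p.a D) (p.b D) (p.c D) (p.d D) p.q (n + 1) =
      ((1 - p.a D * p.b D * p.c D * p.d D * p.q ^ (2 * n + 1)) *
        (qPoch (p.a D * p.b D * p.c D * p.d D) p.q (2 * n + 1) /
          (p.a D ^ (n + 1) * (qPoch p.q p.q (n + 1) * qPoch (p.b D * p.c D) p.q (n + 1) *
            qPoch (p.b D * p.d D) p.q (n + 1) * qPoch (p.c D * p.d D) p.q (n + 1))))) •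
        awMonic (p.a D) (p.b D) (p.c D) (p.d D) p.q (n + 1) := by
  have h := hp.qPoch_abcd_ne (m := n) (n := n + 1) (by omega)
  rw [awMonic_succ, smul_smul, hp.k_succ_eq_qPoch n hn h0,
    show 2 * n + 1 = n + (n + 1) by ring,
    qPoch_add (p.a D * p.b D * p.c D * p.d D) _ n (n + 1)]
  congr 1
  rw [show ∀ x y z w v : ℂ, x * (y / z) * (w / v) = x * y * w / (z * v) by intros; ring]
  exact (div_eq_div_of_common_factor h (by ring) (by ring)).symm

theorem k_smul_poly_top (hp : p.IsQRacah D) (n : ℕ) (hn : n + 2 = D) :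
    p.k D (n + 2) • awPoly (p.a D) (p.b D) (p.c D) (p.d D) p.q (n + 2) =
      (qPoch (p.a D * p.b D * p.c D * p.d D) p.q (2 * n + 3) /
          (p.a D ^ (n + 2) * (qPoch p.q p.q (n + 2) * qPoch (p.b D * p.c D) p.q (n + 2) *
            qPoch (p.b D * p.d D) p.q (n + 2)) * qPoch (p.c D * p.d D) p.q (n + 1))) •
        awMonic (p.a D) (p.b D) (p.c D) (p.d D) p.q (n + 2) := by
  have h := hp.qPoch_abcd_ne (m := n + 1) (n := n + 1 + 1) (by omega)
  rw [awMonic_succ, smul_smul, hp.k_top_eq_qPoch n hn,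
    show 2 * n + 3 = n + 1 + (n + 1 + 1) by ring,
    qPoch_add (p.a D * p.b D * p.c D * p.d D) _ (n + 1) (n + 1 + 1)]
  congr 1
  rw [div_mul_div_comm]
  exact (div_eq_div_of_common_factor h (by ring) (by ring)).symm

end IsQRacah
end QRacahParams

/-! ### The coefficients and g in base q⁻¹ -/

/-- With `y = q^i`, `Q = q^D`, `S = s*`, all three parts follow from the factorization `(y - Q)(1 -
Syq) + (1 - y)(1 - SQyq) = (1 - Q)(1 - Sqy²)` of the numerator of `1 - ϵ_i`. -/
theorem eps_coeff_plus (q y Q S : ℂ) (hq : q ≠ 0) (hy : y ≠ 0) (hQ : Q ≠ 0) (hS : S ≠ 0)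
    (h1 : 1 - Q ≠ 0) (h2 : y - Q ≠ 0) (h3 : 1 - S * y * q ≠ 0) (h4 : 1 - S * q * y ^ 2 ≠ 0) :
    (1 - y⁻¹) * (1 - S⁻¹ * (Q * y * q)⁻¹) / (Q⁻¹ * (1 - Q / y) * (1 - S⁻¹ * (y * q)⁻¹)) /
      ((1 - y⁻¹) * (1 - S⁻¹ * (Q * y * q)⁻¹) / (Q⁻¹ * (1 - Q / y) * (1 - S⁻¹ * (y * q)⁻¹)) - 1) *
        (1 - S * q * y ^ 2) = Q⁻¹ * (1 - y) * (1 - S * Q * y * q) / (Q⁻¹ - 1) ∧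
    1 / (1 - (1 - y⁻¹) * (1 - S⁻¹ * (Q * y * q)⁻¹) / (Q⁻¹ * (1 - Q / y) * (1 - S⁻¹ * (y * q)⁻¹))) *
        (1 - S * q * y ^ 2) = (1 - Q⁻¹ * y) * (1 - S * y * q) / (1 - Q⁻¹) ∧
    y / q * (1 - Q / y) * (1 - S⁻¹ * (y * q)⁻¹) * (1 - (1 - y⁻¹) * (1 - S⁻¹ * (Q * y * q)⁻¹) /
      (Q⁻¹ * (1 - Q / y) * (1 - S⁻¹ * (y * q)⁻¹))) =
        (1 - Q) * (y / q) * (1 - S⁻¹ * (q * y ^ 2)⁻¹) := by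
  have hden : Q⁻¹ * (1 - Q / y) * (1 - S⁻¹ * (y * q)⁻¹) =
      -(y - Q) * (1 - S * y * q) / (Q * S * y ^ 2 * q) := by
    field_simp
    ring
  have hnum : (1 - y⁻¹) * (1 - S⁻¹ * (Q * y * q)⁻¹) =
      (1 - y) * (1 - S * Q * y * q) / (Q * S * y ^ 2 * q) := by
    field_simp
    ring
  have he : (1 - y⁻¹) * (1 - S⁻¹ * (Q * y * q)⁻¹) / (Q⁻¹ * (1 - Q / y) * (1 - S⁻¹ * (y * q)⁻¹)) =
      -((1 - y) * (1 - S * Q * y * q) / ((y - Q) * (1 - S * y * q))) := by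
    rw [hnum, hden, div_div_div_cancel_right₀ (by positivity), neg_mul, div_neg]
  have he1 : 1 - (1 - y⁻¹) * (1 - S⁻¹ * (Q * y * q)⁻¹) /
      (Q⁻¹ * (1 - Q / y) * (1 - S⁻¹ * (y * q)⁻¹)) =
      (1 - Q) * (1 - S * q * y ^ 2) / ((y - Q) * (1 - S * y * q)) := by
    rw [he, sub_neg_eq_add, one_add_div (mul_ne_zero h2 h3)]
    congr 1
    ring
  have hQ1 : Q⁻¹ - 1 = (1 - Q) / Q := by field_simp
  refine ⟨?_, ?_, ?_⟩
  · rw [← neg_sub (1 : ℂ) (_ / _), he1, he, hQ1]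
    generalize 1 - S * q * y ^ 2 = z at h4 ⊢
    generalize 1 - S * y * q = w at h3 ⊢
    generalize 1 - S * Q * y * q = v
    field_simp
  · rw [he1, ← neg_sub Q⁻¹, hQ1]
    generalize 1 - S * q * y ^ 2 = z at h4 ⊢
    generalize 1 - S * y * q = w at h3 ⊢
    field_simp
    ring
  · rw [he1]
    have e1 : y / q * (1 - Q / y) * (1 - S⁻¹ * (y * q)⁻¹) =
        -((y - Q) * (1 - S * y * q) / (S * y * q ^ 2)) := by
      field_simp
      ring
    have e2 : 1 - S⁻¹ * (q * y ^ 2)⁻¹ = -((1 - S * q * y ^ 2) / (S * q * y ^ 2)) := by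
      field_simp
      ring
    rw [e1, e2]
    generalize 1 - S * q * y ^ 2 = z at h4 ⊢
    generalize 1 - S * y * q = w at h3 ⊢
    field_simp

namespace QRacahParams
namespace IsQRacah

variable {p : QRacahParams} {D : ℕ}

theorem qInv_ϵ_eq (hp : p.IsQRacah D) (i : ℕ) :
    p.qInv.ϵ D i = (1 - (p.q ^ i)⁻¹) * (1 - p.ss⁻¹ * (p.q ^ D * p.q ^ i * p.q)⁻¹) /
      ((p.q ^ D)⁻¹ * (1 - p.q ^ D / p.q ^ i) * (1 - p.ss⁻¹ * (p.q ^ i * p.q)⁻¹)) := by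
  have h := hp.q_ne
  simp only [ϵ, qInv_q, qInv_ss, inv_pow, inv_zpow, zpow_sub₀ h, zpow_natCast, inv_div, pow_add,
    pow_one, mul_inv]

theorem qInv_ξ_eq (hp : p.IsQRacah D) (i : ℕ) :
    p.qInv.ξ D i = p.q ^ i / p.q * (1 - p.q ^ D / p.q ^ i) * (1 - p.ss⁻¹ * (p.q ^ i * p.q)⁻¹) := by
  have h := hp.q_ne
  simp only [ξ, qInv_q, qInv_ss, inv_pow, inv_zpow, zpow_sub₀ h, zpow_natCast, inv_div, pow_add,
    pow_one, mul_inv, zpow_one]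

theorem qInv_ϵ_coeff (hp : p.IsQRacah D) (n : ℕ) (hn : n + 2 ≤ D) :
    p.qInv.ϵ D (n + 1) / (p.qInv.ϵ D (n + 1) - 1) *
        (1 - p.a D * p.b D * p.c D * p.d D * p.q ^ (2 * n + 1)) =
      p.a D * p.b D * (1 - p.q ^ (n + 1)) * (1 - p.c D * p.d D * p.q ^ n) /
        (p.a D * p.b D - 1) ∧
    1 / (1 - p.qInv.ϵ D (n + 1)) * (1 - p.a D * p.b D * p.c D * p.d D * p.q ^ (2 * n + 1)) =
      (1 - p.a D * p.b D * p.q ^ (n + 1)) * (1 - p.a D * p.b D * p.c D * p.d D * p.q ^ n) /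
        (1 - p.a D * p.b D) ∧
    p.qInv.ξ D (n + 1) * (1 - p.qInv.ϵ D (n + 1)) = (1 - (p.a D * p.b D)⁻¹) * p.q ^ n *
      (1 - (p.a D * p.b D * p.c D * p.d D * p.q ^ (2 * n + 1))⁻¹) := by
  have hq := hp.q_ne
  have h3 := hp.one_sub_abcd_ne (l := n) (by omega)
  have h4 := hp.one_sub_abcd_ne (l := 2 * n + 1) (by omega)
  have e1 : p.a D * p.b D * p.c D * p.d D * p.q ^ n = p.ss * p.q ^ (n + 1) * p.q := by
    rw [hp.abcd_eq]; ring
  have e2 : p.a D * p.b D * p.c D * p.d D * p.q ^ (2 * n + 1) =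
      p.ss * p.q * (p.q ^ (n + 1)) ^ 2 := by
    rw [hp.abcd_eq]; ring
  have e3 : p.c D * p.d D * p.q ^ n = p.ss * p.q ^ D * p.q ^ (n + 1) * p.q := by
    rw [hp.cd_eq]; ring
  have e4 : p.q ^ (n + 1) / p.q = p.q ^ n := by rw [pow_succ]; field_simp
  rw [e1] at h3
  rw [e2] at h4
  have := eps_coeff_plus p.q (p.q ^ (n + 1)) (p.q ^ D) p.ss hq (hp.qpow_ne _) (hp.qpow_ne _)
    hp.ss_ne (hp.one_sub_qpow_ne (by omega)) (hp.qpow_sub_ne (by omega)) h3 h4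
  rw [e1, e2, e3, hp.ab_eq, hp.qInv_ϵ_eq, hp.qInv_ξ_eq, one_div, inv_inv]
  refine ⟨this.1, this.2.1, this.2.2.trans ?_⟩
  rw [e4, mul_assoc p.ss, mul_inv p.ss]

open LaurentPolynomial in
-- Since `q^D = a⁻¹b⁻¹`, the bracket `y - a⁻¹ - b⁻¹ + q^D y⁻¹` has the roots `a⁻¹` and `b⁻¹`.
theorem qInv_g_eq (hp : p.IsQRacah D) :
    p.qInv.g D = ((p.b D)⁻¹ * ((1 - (p.a D * p.b D * p.c D * p.d D)⁻¹) *
        (1 - (p.a D * p.b D * p.c D * p.d D * p.q)⁻¹) /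
        ((1 - (p.b D * p.c D)⁻¹) * (1 - (p.b D * p.d D)⁻¹)))) •
      ((p.a D)⁻¹ * (p.b D)⁻¹) • (T (-1) * (1 - C (p.a D) * T 1) * (1 - C (p.b D) * T 1)) := by
  have ha := hp.a_ne
  have hb := hp.b_ne
  have hr1 := hp.r1_ne
  have hr2 := hp.r2_ne
  rw [g, qInv_q, qInv_ss, qInv_r1, qInv_r2, qInv_a, qInv_b, hp.abcd_eq, hp.bc_eq, hp.bd_eq]
  congr 1
  · congr 2
    · simp only [inv_pow, mul_inv]; ring_nf
    · simp only [div_eq_mul_inv, mul_inv, inv_inv]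
  · have hT : (T (-1) : LaurentPolynomial ℂ) * T 1 = 1 := by rw [← T_add]; simp
    have hCa : (C (p.a D) : LaurentPolynomial ℂ) * C (p.a D)⁻¹ = 1 := by
      rw [← map_mul, mul_inv_cancel₀ ha, map_one]
    have hCb : (C (p.b D) : LaurentPolynomial ℂ) * C (p.b D)⁻¹ = 1 := by
      rw [← map_mul, mul_inv_cancel₀ hb, map_one]
    have hq : ((p.q⁻¹ ^ D)⁻¹ : ℂ) = (p.a D)⁻¹ * (p.b D)⁻¹ := by
      rw [← mul_inv, hp.ab_eq]; simp
    rw [hq, smul_eq_C_mul, map_mul]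
    generalize (T (-1) : LaurentPolynomial ℂ) = t' at *
    generalize (T 1 : LaurentPolynomial ℂ) = t at *
    generalize (C (p.a D) : LaurentPolynomial ℂ) = x at *
    generalize (C (p.a D)⁻¹ : LaurentPolynomial ℂ) = x' at *
    generalize (C (p.b D) : LaurentPolynomial ℂ) = y at *
    generalize (C (p.b D)⁻¹ : LaurentPolynomial ℂ) = y' at *
    linear_combination (-(x' * y' * x * y * t) + x' * y' * (x + y)) * hT +
      (y' - y * y' * t) * hCa + (x' - t) * hCb

/-- `k_smul_poly` for the reduced array, with the separate factor absorbed: `abcd` becomes `abcd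
q²`, and now the whole factorial `(abcd q²;q)_{2n}` is wanted. -/
theorem perp_k_smul_poly (hp : p.IsQRacah D) (hD : 3 ≤ D) (n : ℕ) (hn : n + 2 ≤ D) :
    p.perp.k (D - 2) n • awPoly (p.a D * p.q) (p.b D * p.q) (p.c D) (p.d D) p.q n =
      (qPoch (p.a D * p.b D * p.c D * p.d D * p.q ^ 2) p.q (2 * n) /
        ((p.a D * p.q) ^ n * (qPoch p.q p.q n * qPoch (p.b D * p.c D * p.q) p.q n *
          qPoch (p.b D * p.d D * p.q) p.q n * qPoch (p.c D * p.d D) p.q n))) •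
        awMonic (p.a D * p.q) (p.b D * p.q) (p.c D) (p.d D) p.q n := by
  have hp' := hp.perp_isQRacah (by omega)
  cases n with
  | zero => simp [hp'.k_zero (by omega), awMonic, qPoch_zero]
  | succ m =>
    have ea := hp.perp_a (by omega)
    have eb := hp.perp_b (by omega)
    have ec := hp.perp_c (by omega)
    have ed := hp.perp_d (by omega)
    have hpq : p.perp.q = p.q := rfl
    have e1 : p.a D * p.q * (p.b D * p.q) * p.c D * p.d D =
        p.a D * p.b D * p.c D * p.d D * p.q ^ 2 := by ring
    have e2 : p.b D * p.q * p.c D = p.b D * p.c D * p.q := by ring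
    have e3 : p.b D * p.q * p.d D = p.b D * p.d D * p.q := by ring
    have h := hp.one_sub_abcd_ne (l := 2 + (2 * m + 1)) (by omega)
    rw [pow_add, ← mul_assoc] at h
    have := hp'.k_smul_poly m (by omega)
    rw [ea, eb, ec, ed, hpq, e1, e2, e3] at this
    rw [this h, show 2 * (m + 1) = 2 * m + 1 + 1 by ring,
      qPoch_succ (p.a D * p.b D * p.c D * p.d D * p.q ^ 2) _ (2 * m + 1)]
    congr 1
    ring

/-- The constants of `k^⊥ p^⊥` and of `g` multiply to minus the coefficient of `P_i` in `ε^+_{i-1}`,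
times `ξ_i(1 - ϵ_i)`. This is why `ε^+_{i-1}` is a multiple of `P_i - Q_i`. -/
theorem perp_coeff (hp : p.IsQRacah D) (n : ℕ) (hn : n + 2 ≤ D) :
    qPoch (p.a D * p.b D * p.c D * p.d D * p.q ^ 2) p.q (2 * n) /
        ((p.a D * p.q) ^ n * (qPoch p.q p.q n * qPoch (p.b D * p.c D * p.q) p.q n *
          qPoch (p.b D * p.d D * p.q) p.q n * qPoch (p.c D * p.d D) p.q n)) *
      ((p.b D)⁻¹ * ((1 - (p.a D * p.b D * p.c D * p.d D)⁻¹) *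
        (1 - (p.a D * p.b D * p.c D * p.d D * p.q)⁻¹) /
        ((1 - (p.b D * p.c D)⁻¹) * (1 - (p.b D * p.d D)⁻¹)))) =
    -(p.a D * p.b D * (1 - p.q ^ (n + 1)) * (1 - p.c D * p.d D * p.q ^ n) / (p.a D * p.b D - 1) *
      (qPoch (p.a D * p.b D * p.c D * p.d D) p.q (2 * n + 1) /
        (p.a D ^ (n + 1) * (qPoch p.q p.q (n + 1) * qPoch (p.b D * p.c D) p.q (n + 1) *
          qPoch (p.b D * p.d D) p.q (n + 1) * qPoch (p.c D * p.d D) p.q (n + 1))))) *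
      ((1 - (p.a D * p.b D)⁻¹) * p.q ^ n *
        (1 - (p.a D * p.b D * p.c D * p.d D * p.q ^ (2 * n + 1))⁻¹)) := by
  have hq := hp.q_ne
  have ha := hp.a_ne
  have hb := hp.b_ne
  have hc := hp.c_ne
  have hd := hp.d_ne
  have hqn := hp.qpow_ne n
  have h1 := hp.one_sub_abcd_ne (l := 2 * n + 1) (by omega)
  have h2 := hp.one_sub_qpow_ne (i := n + 1) (by omega)
  have h3 := hp.one_sub_cd_ne (l := n) (by omega)
  have h4 := hp.one_sub_bc_ne (l := 0) (by omega)
  have h5 := hp.one_sub_bd_ne (l := 0) (by omega)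
  have h6 := hp.one_sub_ab_ne (l := 0) (by omega)
  rw [pow_zero, mul_one] at h4 h5 h6
  have e1 : qPoch (p.a D * p.b D * p.c D * p.d D) p.q (2 * n + 1) =
      (1 - p.a D * p.b D * p.c D * p.d D) * (1 - p.a D * p.b D * p.c D * p.d D * p.q) *
        qPoch (p.a D * p.b D * p.c D * p.d D * p.q ^ 2) p.q (2 * n) /
        (1 - p.a D * p.b D * p.c D * p.d D * p.q ^ (2 * n + 1)) := by
    rw [eq_div_iff h1, ← qPoch_succ, show 2 * n + 1 + 1 = 2 + 2 * n by ring, qPoch_add,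
      qPoch_succ, qPoch_one, pow_one]
  have e2 : qPoch p.q p.q (n + 1) = qPoch p.q p.q n * (1 - p.q ^ (n + 1)) := by
    rw [qPoch_succ, pow_succ']
  have e3 : 1 - (p.a D * p.b D * p.c D * p.d D)⁻¹ = -(1 - p.a D * p.b D * p.c D * p.d D) /
      (p.a D * p.b D * p.c D * p.d D) := by field_simp; ring
  have e4 : 1 - (p.a D * p.b D * p.c D * p.d D * p.q)⁻¹ =
      -(1 - p.a D * p.b D * p.c D * p.d D * p.q) / (p.a D * p.b D * p.c D * p.d D * p.q) := by
    field_simp; ring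
  have e5 : 1 - (p.a D * p.b D * p.c D * p.d D * p.q ^ (2 * n + 1))⁻¹ =
      -(1 - p.a D * p.b D * p.c D * p.d D * p.q ^ (2 * n + 1)) /
        (p.a D * p.b D * p.c D * p.d D * p.q ^ (2 * n + 1)) := by field_simp; ring
  have e6 : 1 - (p.b D * p.c D)⁻¹ = -(1 - p.b D * p.c D) / (p.b D * p.c D) := by field_simp; ring
  have e7 : 1 - (p.b D * p.d D)⁻¹ = -(1 - p.b D * p.d D) / (p.b D * p.d D) := by field_simp; ring
  have e8 : 1 - (p.a D * p.b D)⁻¹ = -(1 - p.a D * p.b D) / (p.a D * p.b D) := by field_simp; ring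
  have e9 : p.q ^ (2 * n + 1) = (p.q ^ n) ^ 2 * p.q := by ring
  rw [e3, e4, e5, e6, e7, e8, e1, e2, qPoch_succ' (p.b D * p.c D), qPoch_succ' (p.b D * p.d D),
    qPoch_succ (p.c D * p.d D), ← neg_sub 1 (p.a D * p.b D), mul_pow, pow_succ (p.a D)]
  generalize qPoch (p.a D * p.b D * p.c D * p.d D * p.q ^ 2) p.q (2 * n) = L
  generalize qPoch p.q p.q n = M1
  generalize qPoch (p.b D * p.c D * p.q) p.q n = M2
  generalize qPoch (p.b D * p.d D * p.q) p.q n = M3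
  generalize qPoch (p.c D * p.d D) p.q n = M4
  generalize 1 - p.a D * p.b D * p.c D * p.d D * p.q ^ (2 * n + 1) = z1 at h1 ⊢
  generalize 1 - p.q ^ (n + 1) = z2 at h2 ⊢
  generalize 1 - p.c D * p.d D * p.q ^ n = z3 at h3 ⊢
  generalize 1 - p.b D * p.c D = z4 at h4 ⊢
  generalize 1 - p.b D * p.d D = z5 at h5 ⊢
  generalize 1 - p.a D * p.b D * p.c D * p.d D * p.q = z7
  generalize 1 - p.a D * p.b D * p.c D * p.d D = z8
  generalize 1 - p.a D * p.b D = z6 at h6 ⊢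
  rw [e9]
  generalize p.q ^ n = x at hqn ⊢
  field_simp

/-- The second summand of `ε^±` in base `q⁻¹`, as a multiple of `awQ`. -/
theorem qInv_perp_term (hp : p.IsQRacah D) (hD : 3 ≤ D) (n : ℕ) (hn : n + 2 ≤ D) :
    (1 / (p.qInv.ξ D (n + 1) * (1 - p.qInv.ϵ D (n + 1))) * p.qInv.perp.k (D - 2) n) •
      (p.qInv.polyPerp D n * p.qInv.g D) =
    (-(p.a D * p.b D * (1 - p.q ^ (n + 1)) * (1 - p.c D * p.d D * p.q ^ n) / (p.a D * p.b D - 1) *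
      (qPoch (p.a D * p.b D * p.c D * p.d D) p.q (2 * n + 1) /
        (p.a D ^ (n + 1) * (qPoch p.q p.q (n + 1) * qPoch (p.b D * p.c D) p.q (n + 1) *
          qPoch (p.b D * p.d D) p.q (n + 1) * qPoch (p.c D * p.d D) p.q (n + 1)))))) •
      awQ (p.a D) (p.b D) (p.c D) (p.d D) p.q (n + 1) := by
  have hp' := hp.perp_isQRacah (by omega)
  have hX : p.qInv.ξ D (n + 1) * (1 - p.qInv.ϵ D (n + 1)) ≠ 0 := by
    rw [(hp.qInv_ϵ_coeff n hn).2.2]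
    have h1 := hp.one_sub_abcd_ne (l := 2 * n + 1) (by omega)
    have h6 := hp.one_sub_ab_ne (l := 0) (by omega)
    rw [pow_zero, mul_one] at h6
    refine mul_ne_zero (mul_ne_zero ?_ (hp.qpow_ne n)) ?_
    · exact fun h => h6 (by rw [sub_eq_zero, eq_comm, inv_eq_one] at h; rw [h, sub_self])
    · exact fun h => h1 (by rw [sub_eq_zero, eq_comm, inv_eq_one] at h; rw [h, sub_self])
  have hpoly : p.qInv.polyPerp D n =
      awPoly (p.a D * p.q) (p.b D * p.q) (p.c D) (p.d D) p.q n := by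
    rw [polyPerp, qInv_a, qInv_b, qInv_c, qInv_d, qInv_q, ← mul_inv, ← mul_inv]
    exact awPoly_inv _ _ _ _ _ (mul_ne_zero hp.a_ne hp.q_ne) (mul_ne_zero hp.b_ne hp.q_ne) hp.c_ne
      hp.d_ne hp.q_ne n
  have hc := hp.perp_coeff n hn
  rw [← (hp.qInv_ϵ_coeff n hn).2.2] at hc
  rw [hp.qInv_perp, hp'.qInv_k, mul_smul, ← smul_mul_assoc, hpoly, hp.perp_k_smul_poly hD n hn,
    hp.qInv_g_eq, awQ, Nat.add_sub_cancel]
  generalize (p.qInv.ξ D (n + 1) * (1 - p.qInv.ϵ D (n + 1))) = X at hX hc ⊢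
  rw [smul_mul_assoc, mul_smul_comm, smul_smul, smul_smul, mul_assoc, hc]
  rw [show ∀ K : ℂ, 1 / X * (K * X) = K by intro K; field_simp]
  rw [mul_smul_comm, mul_comm (awMonic _ _ _ _ _ _)]

theorem qInv_poly (hp : p.IsQRacah D) (n : ℕ) :
    p.qInv.poly D n = awPoly (p.a D) (p.b D) (p.c D) (p.d D) p.q n := by
  rw [poly, qInv_a, qInv_b, qInv_c, qInv_d, qInv_q]
  exact awPoly_inv _ _ _ _ _ hp.a_ne hp.b_ne hp.c_ne hp.d_ne hp.q_ne n

end IsQRacah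
end QRacahParams

/-! ### Assembling the proposition -/

theorem proposition10p7 (D : ℕ) (hD : 3 ≤ D) (p : QRacahParams) (hp : p.IsQRacah D)
    (a b c d q : ℂ) (ha : a = p.a D) (hb : b = p.b D) (hc : c = p.c D) (hd : d = p.d D)
    (hq : q = p.q) :
    (∀ i : ℕ, 1 ≤ i → i ≤ D - 1 →
      p.qInv.epsPlus D (i - 1) =
        (a * b * (1 - q ^ i) * (1 - c * d * q ^ (i - 1)) / (a * b - 1) *
          (qPoch (a * b * c * d) q (2 * i - 1) /
            (a ^ i * (qPoch q q i * qPoch (b * c) q i * qPoch (b * d) q i *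
              qPoch (c * d) q i)))) •
          (awMonic a b c d q i - awQ a b c d q i) ∧
      p.qInv.epsMinus D i =
        ((1 - a * b * q ^ i) * (1 - a * b * c * d * q ^ (i - 1)) / (1 - a * b) *
          (qPoch (a * b * c * d) q (2 * i - 1) /
            (a ^ i * (qPoch q q i * qPoch (b * c) q i * qPoch (b * d) q i *
              qPoch (c * d) q i)))) •
          (awMonic a b c d q i -
            (a * b * (1 - q ^ i) * (1 - c * d * q ^ (i - 1)) /
              ((1 - a * b * q ^ i) * (1 - a * b * c * d * q ^ (i - 1)))) •
              awQ a b c d q i)) ∧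
    p.qInv.epsMinus D 0 = 1 ∧
    p.qInv.epsPlus D (D - 1) =
      (qPoch (a * b * c * d) q (2 * D - 1) /
        (a ^ D * (qPoch q q D * qPoch (b * c) q D * qPoch (b * d) q D) *
          qPoch (c * d) q (D - 1))) •
        awMonic a b c d q D := by 
  subst ha hb hc hd hq
  refine ⟨fun i h1 h2 => ?_, if_pos rfl, ?_⟩
  · obtain ⟨n, rfl⟩ : ∃ n, i = n + 1 := ⟨i - 1, by omega⟩
    have hn : n + 2 ≤ D := by omega
    have hu := hp.one_sub_abcd_ne (l := 2 * n + 1) (by omega)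
    have hk := hp.k_smul_poly n (by omega) hu
    have ht := hp.qInv_perp_term hD n hn
    obtain ⟨e1, e2, -⟩ := hp.qInv_ϵ_coeff n hn
    have h3 := hp.one_sub_ab_ne (l := n + 1) (by omega)
    have h4 := hp.one_sub_abcd_ne (l := n) (by omega)
    rw [Nat.add_sub_cancel, show 2 * (n + 1) - 1 = 2 * n + 1 by omega]
    constructor
    · rw [QRacahParams.epsPlus, if_neg (by omega), ht, hp.qInv_k, hp.qInv_poly, mul_smul, hk,
        smul_smul, ← mul_assoc, e1]
      module
    -- The second summand of `ε^-_i` is the negative of that of `ε^+_{i-1}`, so the same multiple of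
    -- `Q_i` serves both.
    · rw [QRacahParams.epsMinus, if_neg (by omega), Nat.add_sub_cancel, hp.qInv_k, hp.qInv_poly,
        mul_smul, hk, smul_smul, ← mul_assoc, e2, ← neg_sub (1 : ℂ) (p.qInv.ϵ D (n + 1)), mul_neg,
        div_neg, neg_mul, neg_smul, ht, smul_sub, smul_smul, ← neg_sub (1 : ℂ) (p.a D * p.b D)]
      -- The coefficient of `P_i` times the ratio in front of `Q_i`: the nonzero factors `1 - abq^i`
      -- and `1 - abcdq^{i-1}` cancel, and the sign is that of `ab - 1` against `1 - ab`.
      have e3 : ∀ K : ℂ, (1 - p.a D * p.b D * p.q ^ (n + 1)) *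
          (1 - p.a D * p.b D * p.c D * p.d D * p.q ^ n) / (1 - p.a D * p.b D) * K *
          (p.a D * p.b D * (1 - p.q ^ (n + 1)) * (1 - p.c D * p.d D * p.q ^ n) /
            ((1 - p.a D * p.b D * p.q ^ (n + 1)) *
              (1 - p.a D * p.b D * p.c D * p.d D * p.q ^ n))) =
          -(p.a D * p.b D * (1 - p.q ^ (n + 1)) * (1 - p.c D * p.d D * p.q ^ n) /
            -(1 - p.a D * p.b D) * K) := by
        intro K
        generalize 1 - p.a D * p.b D * p.q ^ (n + 1) = z at h3 ⊢
        generalize 1 - p.a D * p.b D * p.c D * p.d D * p.q ^ n = w at h4 ⊢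
        generalize 1 - p.c D * p.d D * p.q ^ n = v
        generalize 1 - p.q ^ (n + 1) = y
        generalize 1 - p.a D * p.b D = u
        rw [div_neg]
        field_simp
      rw [e3]
      exact (sub_eq_add_neg _ _).symm
  · obtain ⟨n, rfl⟩ : ∃ n, D = n + 2 := ⟨D - 2, by omega⟩
    have hk := hp.k_smul_poly_top n rfl
    rw [QRacahParams.epsPlus, if_pos (by omega), hp.qInv_k, hp.qInv_poly, hk]
    rfl

end
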